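/- Let $F$ be a field and let $G$ be a linear algebraic group over $F$, that is, an affine group scheme of finite type over $F$ (possibly non-reduced or disconnected). For a finite-dimensional $F$-vector space $W$ and $n \geq 1$, let $\Gamma^n(W) = (W^{\otimes n})^{S_n}$ be the $n$-th divided power of $W$, for $w\in W$ put $[w]_n = w \otimes \cdots \otimes w \in \Gamma^n(W)$, let $\mathbb{P}(V)$ denote the projective space of lines in $V$, and let $\mathrm{Ver}_n : \mathbb{P}(W) \to \mathbb{P}(\Gamma^n(W))$, $(w) \mapsto ([w]_n)$, be the $n$-th Veronese embedding. The group scheme $\mathrm{PGL}(W)$ acts on the Grassmannian $\mathrm{Gr}(l,\Gamma^n(W))$ of $l$-dimensional subspaces; for $L \in \mathrm{Gr}(l,\Gamma^n(W))(F)$ let $\mathrm{Stab}_{\mathrm{PGL}(W)}(L) \subset \mathrm{PGL}(W)$ be the subgroup scheme with $\mathrm{Stab}_{\mathrm{PGL}(W)}(L)(A) = \{g \in \mathrm{PGL}(W)(A) : g(L_A) = L_A\}$ for every commutative $F$-algebra $A$, where $L_A = L \otimes_F A$. Then there exist a finite-dimensional $F$-vector space $W$, integers $n, l \geq 1$, and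 a linear subspace $L \subset \Gamma^n(W)$ of dimension $l$, such that $$G \simeq \mathrm{Stab}_{\mathrm{PGL}(W)}(L)$$ as group schemes over $F$. Moreover, $L$ can be chosen such that, in addition, the closed subvarieties $\mathbb{P}(L)$ and $\mathrm{Ver}_n(\mathbb{P}(W))$ of $\mathbb{P}(\Gamma^n(W))$ do not intersect, i.e. have no common point over any field extension of $F$. -/

import Mathlib

open CategoryTheory AlgebraicGeometry
open scoped TensorProduct LinearAlgebra.Projectivization

universe u

noncomputable section

namespace DividedTannaka

section DividedPowers

variable (A : Type*) [CommRing A] (n : ℕ) (M : Type*) [AddCommGroup M] [Module A M]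

/-- The `n`-th divided power `Γⁿ(M) = H⁰(Sₙ, M^{⊗ n})`: the tensors invariant under the
permutation action of the symmetric group. -/
def DividedPower : Submodule A (⨂[A]^n M) where
  carrier := {t | ∀ σ : Equiv.Perm (Fin n), PiTensorProduct.reindex A (fun _ => M) σ t = t}
  zero_mem' := fun σ => map_zero _
  add_mem' := fun {s t} hs ht σ => by
    have h := (PiTensorProduct.reindex A (fun _ => M) σ).map_add s t
    rw [hs σ, ht σ] at h
    exact h
  smul_mem' := fun c t ht σ => by
    have h := (PiTensorProduct.reindex A (fun _ => M) σ).map_smul c t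
    rw [ht σ] at h
    exact h

instance : AddCommGroup (DividedPower A n M) := Submodule.addCommGroup _

variable {M}

/-- The pure symbol `[v]ₙ = v ⊗ ⋯ ⊗ v`. -/
def pureSymbol (v : M) : DividedPower A n M :=
  ⟨PiTensorProduct.tprod A fun _ => v, fun σ => PiTensorProduct.reindex_tprod σ _⟩

variable {A}
variable {B : Type*} [CommRing B] [Algebra A B] {N : Type*} [AddCommGroup N] [Module B N]
  [Module A N] [IsScalarTower A B N]

/-- The map `M^{⊗_A n} → N^{⊗_B n}`, `m₁ ⊗ ⋯ ⊗ mₙ ↦ ι m₁ ⊗ ⋯ ⊗ ι mₙ`, attached to an `A`-linear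
map `ι` from an `A`-module `M` to a `B`-module `N`, where `B` is an `A`-algebra. -/
def tensorPowerMap (ι : M →ₗ[A] N) : ⨂[A]^n M →ₗ[A] ⨂[B]^n N :=
  PiTensorProduct.lift
    (((PiTensorProduct.tprod B (s := fun _ : Fin n => N)).restrictScalars A).compLinearMap
      fun _ => ι)

theorem tensorPowerMap_tprod (ι : M →ₗ[A] N) (m : Fin n → M) :
    tensorPowerMap (B := B) n ι (PiTensorProduct.tprod A m) =
      PiTensorProduct.tprod B fun i => ι (m i) := by
  simp [tensorPowerMap]

theorem reindex_tprod_const (σ : Equiv.Perm (Fin n)) (m : Fin n → M) :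
    PiTensorProduct.reindex A (fun _ => M) σ (PiTensorProduct.tprod A m) =
      PiTensorProduct.tprod A fun i => m (σ.symm i) :=
  PiTensorProduct.reindex_tprod σ m

theorem tensorPowerMap_reindex (ι : M →ₗ[A] N) (σ : Equiv.Perm (Fin n)) (t : ⨂[A]^n M) :
    tensorPowerMap (B := B) n ι (PiTensorProduct.reindex A (fun _ => M) σ t) =
      PiTensorProduct.reindex B (fun _ => N) σ (tensorPowerMap n ι t) := by
  induction t using PiTensorProduct.induction_on with
  | smul_tprod r m =>
    have h : tensorPowerMap (B := B) n ι
        (PiTensorProduct.reindex A (fun _ => M) σ (PiTensorProduct.tprod A m)) =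
        PiTensorProduct.reindex B (fun _ => N) σ
          (tensorPowerMap n ι (PiTensorProduct.tprod A m)) := by
      rw [reindex_tprod_const, tensorPowerMap_tprod, tensorPowerMap_tprod, reindex_tprod_const]
    have h1 := (PiTensorProduct.reindex A (fun _ : Fin n => M) σ).map_smul r
      (PiTensorProduct.tprod A m)
    have h2 := ((PiTensorProduct.reindex B
      (fun _ : Fin n => N) σ).toLinearMap.restrictScalars A).map_smul r
        (tensorPowerMap n ι (PiTensorProduct.tprod A m))
    rw [map_smul (tensorPowerMap (B := B) n ι)]
    refine (congrArg (tensorPowerMap (B := B) n ι) h1).trans ?_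
    rw [map_smul (tensorPowerMap (B := B) n ι), h]
    exact h2.symm
  | add x y hx hy =>
    have h1 := (PiTensorProduct.reindex A (fun _ : Fin n => M) σ).map_add x y
    have h2 := (PiTensorProduct.reindex B (fun _ : Fin n => N) σ).map_add
      (tensorPowerMap n ι x) (tensorPowerMap n ι y)
    rw [map_add (tensorPowerMap (B := B) n ι)]
    refine (congrArg (tensorPowerMap (B := B) n ι) h1).trans ?_
    rw [map_add (tensorPowerMap (B := B) n ι)]
    refine Eq.trans ?_ h2.symm
    exact congrArg₂ (· + ·) hx hy

/-- The map `Γⁿ_A(M) → Γⁿ_B(N)` induced by `ι : M → N`. For `B = A` this is the functoriality of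
the divided power; for `N = B ⊗ M` and `ι m = 1 ⊗ m` it is extension of scalars. -/
def dividedPowerMap (ι : M →ₗ[A] N) : DividedPower A n M →ₗ[A] DividedPower B n N where
  toFun t := ⟨tensorPowerMap n ι t, fun σ => by
    rw [← tensorPowerMap_reindex, t.2 σ]⟩
  map_add' s t := Subtype.ext (by simp)
  map_smul' c t := Subtype.ext (by simp)

variable (B) in
/-- The `B`-submodule `L_B` of `Γⁿ_B(B ⊗ M)` spanned by a submodule `L` of `Γⁿ_A(M)`. -/
def extendScalars (L : Submodule A (DividedPower A n M)) :
    Submodule B (DividedPower B n (B ⊗[A] M)) :=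
  Submodule.span B (dividedPowerMap n (TensorProduct.mk A B M 1) '' (L : Set (DividedPower A n M)))

theorem dividedPowerMap_comp {C : Type*} [CommRing C] [Algebra A C] [Algebra B C]
    [IsScalarTower A B C] {P : Type*} [AddCommGroup P] [Module A P] [Module B P] [Module C P]
    [IsScalarTower A C P] [IsScalarTower B C P] [IsScalarTower A B P]
    (κ : N →ₗ[B] P) (ι : M →ₗ[A] N) (t : DividedPower A n M) :
    dividedPowerMap (B := C) n κ (dividedPowerMap (B := B) n ι t) =
      dividedPowerMap (B := C) n (κ.restrictScalars A ∘ₗ ι) t := by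
  apply Subtype.ext
  change tensorPowerMap (B := C) n κ (tensorPowerMap (B := B) n ι t) =
    tensorPowerMap (B := C) n (κ.restrictScalars A ∘ₗ ι) t
  generalize (t : ⨂[A]^n M) = t
  induction t using PiTensorProduct.induction_on with
  | smul_tprod r m =>
    rw [map_smul (tensorPowerMap (B := B) n ι), LinearMap.map_smul_of_tower,
      map_smul (tensorPowerMap (B := C) n _), tensorPowerMap_tprod,
      tensorPowerMap_tprod, tensorPowerMap_tprod]
    rfl
  | add x y hx hy => rw [map_add, map_add, map_add, hx, hy]

end DividedPowers

section PGL

variable {F : Type u} [Field F] (W : Type u) [AddCommGroup W] [Module F W]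
variable {A B C : Type u} [CommRing A] [Algebra F A] [CommRing B] [Algebra F B]
  [CommRing C] [Algebra F C]

variable (F A) in
/-- The group `PGL(W)(A)` of `A`-points of the projective linear group of `W`: the automorphisms
of the `A`-algebra `A ⊗ End(W)`. -/
abbrev PGLPoints : Type u := (A ⊗[F] Module.End F W) ≃ₐ[A] (A ⊗[F] Module.End F W)

variable {W}

/-- The ring map `A ⊗ End(W) → B ⊗ End(W)` given by a map of `F`-algebras `A → B`. -/
abbrev endMap (f : A →ₐ[F] B) : A ⊗[F] Module.End F W →ₐ[F] B ⊗[F] Module.End F W :=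
  Algebra.TensorProduct.map f (AlgHom.id F (Module.End F W))

/-- The extension along `A → B` of an `A`-algebra endomorphism of `A ⊗ End(W)`. -/
def endExtend (f : A →ₐ[F] B) (φ : A ⊗[F] Module.End F W →ₐ[A] A ⊗[F] Module.End F W) :
    B ⊗[F] Module.End F W →ₐ[B] B ⊗[F] Module.End F W :=
  Algebra.TensorProduct.lift (Algebra.ofId B _)
    ((endMap f).comp ((φ.restrictScalars F).comp Algebra.TensorProduct.includeRight))
    fun b _ => Algebra.commutes b _

theorem endExtend_endMap (f : A →ₐ[F] B)
    (φ : A ⊗[F] Module.End F W →ₐ[A] A ⊗[F] Module.End F W) (x : A ⊗[F] Module.End F W) :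
    endExtend f φ (endMap f x) = endMap f (φ x) := by
  induction x using TensorProduct.induction_on with
  | zero => simp
  | add x y hx hy => simp only [map_add, hx, hy]
  | tmul a e =>
    have h : (a ⊗ₜ[F] e : A ⊗[F] Module.End F W) = a • (1 ⊗ₜ[F] e) := by
      simp [TensorProduct.smul_tmul']
    have h2 (y : A ⊗[F] Module.End F W) : endMap f (a • y) = f a • endMap f y := by
      induction y using TensorProduct.induction_on with
      | zero => simp
      | add x y hx hy => simp only [map_add, smul_add, hx, hy]
      | tmul b e => simp [TensorProduct.smul_tmul']
    rw [h, h2, map_smul (endExtend f φ), map_smul φ, h2]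
    rw [show endMap f (1 ⊗ₜ[F] e : A ⊗[F] Module.End F W) = 1 ⊗ₜ[F] e by simp, endExtend]
    exact congrArg (f a • ·) ((Algebra.TensorProduct.lift_tmul _ _ _ _ _).trans (by
      rw [map_one, one_mul]
      rfl))

theorem endExtend_ext {f : A →ₐ[F] B}
    {φ ψ : B ⊗[F] Module.End F W →ₐ[B] B ⊗[F] Module.End F W}
    (h : ∀ x : A ⊗[F] Module.End F W, φ (endMap f x) = ψ (endMap f x)) : φ = ψ := by
  apply Algebra.TensorProduct.ext (by ext)
  apply AlgHom.ext
  intro e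
  simpa using h (1 ⊗ₜ e)

theorem endExtend_comp (f : A →ₐ[F] B)
    (φ ψ : A ⊗[F] Module.End F W →ₐ[A] A ⊗[F] Module.End F W) :
    endExtend f (φ.comp ψ) = (endExtend f φ).comp (endExtend f ψ) :=
  endExtend_ext (f := f) fun x => by
    simp only [AlgHom.comp_apply, endExtend_endMap]

theorem endExtend_id (f : A →ₐ[F] B) :
    endExtend f (AlgHom.id A (A ⊗[F] Module.End F W)) = AlgHom.id B _ :=
  endExtend_ext (f := f) fun x => by
    simp only [endExtend_endMap, AlgHom.id_apply]

/-- The extension along `A → B` of an automorphism of the `A`-algebra `A ⊗ End(W)`. -/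
def pglExtend (f : A →ₐ[F] B) (φ : PGLPoints F W A) : PGLPoints F W B :=
  AlgEquiv.ofAlgHom (endExtend f φ) (endExtend f φ.symm)
    (by rw [← endExtend_comp, AlgEquiv.comp_symm, endExtend_id])
    (by rw [← endExtend_comp, AlgEquiv.symm_comp, endExtend_id])

theorem pglExtend_endMap (f : A →ₐ[F] B) (φ : PGLPoints F W A) (x : A ⊗[F] Module.End F W) :
    pglExtend f φ (endMap f x) = endMap f (φ x) := by
  have h := endExtend_endMap f (φ : A ⊗[F] Module.End F W →ₐ[A] A ⊗[F] Module.End F W) x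
  rw [AlgEquiv.coe_toAlgHom] at h
  rw [← h, pglExtend, AlgEquiv.ofAlgHom_apply]

theorem pgl_ext (f : A →ₐ[F] B) {φ ψ : PGLPoints F W B}
    (h : ∀ x : A ⊗[F] Module.End F W, φ (endMap f x) = ψ (endMap f x)) : φ = ψ :=
  AlgEquiv.coe_toAlgHom_injective (endExtend_ext h)

/-- The homomorphism `PGL(W)(A) → PGL(W)(B)` given by a map of `F`-algebras `A → B`. -/
def pglMap (f : A →ₐ[F] B) : PGLPoints F W A →* PGLPoints F W B where
  toFun φ := pglExtend f φ
  map_one' := pgl_ext f fun x => pglExtend_endMap f 1 x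
  map_mul' φ ψ := pgl_ext f fun x => by
    rw [pglExtend_endMap, AlgEquiv.mul_apply, AlgEquiv.mul_apply, pglExtend_endMap,
      pglExtend_endMap]

theorem pglMap_endMap (f : A →ₐ[F] B) (φ : PGLPoints F W A) (x : A ⊗[F] Module.End F W) :
    pglMap f φ (endMap f x) = endMap f (φ x) :=
  pglExtend_endMap f φ x

theorem pglMap_id (φ : PGLPoints F W A) : pglMap (AlgHom.id F A) φ = φ :=
  pgl_ext (AlgHom.id F A) fun x => by
    rw [pglMap_endMap]
    simp [endMap]

theorem pglMap_comp (g : B →ₐ[F] C) (f : A →ₐ[F] B) (φ : PGLPoints F W A) :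
    pglMap (g.comp f) φ = pglMap g (pglMap f φ) :=
  pgl_ext (g.comp f) fun x => by
    have h (y : A ⊗[F] Module.End F W) : endMap (g.comp f) y = endMap g (endMap f y) := by
      simp only [endMap, ← AlgHom.comp_apply, ← Algebra.TensorProduct.map_comp, AlgHom.comp_id]
    rw [pglMap_endMap, h, h, pglMap_endMap, pglMap_endMap]

/-- The element `φ` of `PGL(W)(A)` is the class of `g ∈ GL(W)(A) = GL(A ⊗ W)`: it is conjugation
by `g`, where elements of `A ⊗ End(W)` are viewed as endomorphisms of `A ⊗ W`. -/
def IsClassOf (φ : PGLPoints F W A) (g : (A ⊗[F] W) ≃ₗ[A] (A ⊗[F] W)) : Prop :=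
  ∀ (x : A ⊗[F] Module.End F W) (w : A ⊗[F] W),
    LinearMap.tensorProductEnd F A W (φ x) (g w) = g (LinearMap.tensorProductEnd F A W x w)

/-- The linear automorphism `g` of `A ⊗ W` satisfies `g(L_A) = L_A`, for the induced action on
`Γⁿ_A(A ⊗ W)`. -/
def Stabilizes {n : ℕ} (L : Submodule F (DividedPower F n W))
    (g : (A ⊗[F] W) ≃ₗ[A] (A ⊗[F] W)) : Prop :=
  (extendScalars n A L).map (dividedPowerMap (B := A) n g.toLinearMap) = extendScalars n A L

theorem dividedPowerMap_refl {R M : Type*} [CommRing R] [AddCommGroup M] [Module R M] {n : ℕ}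
    (t : DividedPower R n M) : dividedPowerMap (B := R) n (LinearMap.id : M →ₗ[R] M) t = t := by
  apply Subtype.ext
  change tensorPowerMap (B := R) n LinearMap.id (t : ⨂[R]^n M) = t
  generalize (t : ⨂[R]^n M) = t
  induction t using PiTensorProduct.induction_on with
  | smul_tprod r m =>
    rw [map_smul (tensorPowerMap (B := R) n _), tensorPowerMap_tprod]
    rfl
  | add x y hx hy => rw [map_add, hx, hy]

section Stab

variable {n : ℕ} {L : Submodule F (DividedPower F n W)}

theorem IsClassOf.one : IsClassOf (1 : PGLPoints F W A) (LinearEquiv.refl A (A ⊗[F] W)) :=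
  fun _ _ => rfl

theorem IsClassOf.mul {φ ψ : PGLPoints F W A} {g h : (A ⊗[F] W) ≃ₗ[A] (A ⊗[F] W)}
    (hφ : IsClassOf φ g) (hψ : IsClassOf ψ h) : IsClassOf (φ * ψ) (h.trans g) := fun x w => by
  rw [AlgEquiv.mul_apply, LinearEquiv.trans_apply, LinearEquiv.trans_apply, hφ, hψ]

theorem IsClassOf.inv {φ : PGLPoints F W A} {g : (A ⊗[F] W) ≃ₗ[A] (A ⊗[F] W)}
    (hφ : IsClassOf φ g) : IsClassOf φ⁻¹ g.symm := fun x w => by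
  apply g.injective
  rw [← hφ, ← AlgEquiv.mul_apply, mul_inv_cancel, AlgEquiv.one_apply,
    LinearEquiv.apply_symm_apply, LinearEquiv.apply_symm_apply]

theorem Stabilizes.one : Stabilizes L (LinearEquiv.refl A (A ⊗[F] W)) := by
  have h : dividedPowerMap (B := A) n (LinearEquiv.refl A (A ⊗[F] W)).toLinearMap =
      LinearMap.id := LinearMap.ext fun t => dividedPowerMap_refl t
  rw [Stabilizes, h, Submodule.map_id]

theorem dividedPowerMap_trans (g h : (A ⊗[F] W) ≃ₗ[A] (A ⊗[F] W)) :
    dividedPowerMap (B := A) n (h.trans g).toLinearMap =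
      dividedPowerMap (B := A) n g.toLinearMap ∘ₗ dividedPowerMap (B := A) n h.toLinearMap :=
  LinearMap.ext fun t => (dividedPowerMap_comp n g.toLinearMap h.toLinearMap t).symm

theorem Stabilizes.mul {g h : (A ⊗[F] W) ≃ₗ[A] (A ⊗[F] W)}
    (hg : Stabilizes L g) (hh : Stabilizes L h) : Stabilizes L (h.trans g) := by
  rw [Stabilizes, dividedPowerMap_trans, Submodule.map_comp, hh, hg]

theorem Stabilizes.inv {g : (A ⊗[F] W) ≃ₗ[A] (A ⊗[F] W)}
    (hg : Stabilizes L g) : Stabilizes L g.symm := by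
  have h := dividedPowerMap_trans (n := n) g.symm g
  have h1 : (Stabilizes L (g.trans g.symm)) := by
    rw [LinearEquiv.self_trans_symm]
    exact Stabilizes.one
  rw [Stabilizes, h, Submodule.map_comp, hg] at h1
  exact h1

variable [Algebra A B] [IsScalarTower F A B]

variable (W A B) in
/-- The natural map `A ⊗ W → B ⊗ W`. -/
def vecMap : A ⊗[F] W →ₗ[A] B ⊗[F] W :=
  TensorProduct.AlgebraTensorModule.rTensor F W (Algebra.linearMap A B)

theorem vecMap_one (w : W) : vecMap W A B (1 ⊗ₜ[F] w) = 1 ⊗ₜ[F] w := by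
  simp [vecMap]

theorem vec_ext {g h : B ⊗[F] W →ₗ[B] B ⊗[F] W}
    (H : ∀ x : A ⊗[F] W, g (vecMap W A B x) = h (vecMap W A B x)) : g = h := by
  apply TensorProduct.AlgebraTensorModule.curry_injective
  apply LinearMap.ext_ring
  ext w
  simpa [vecMap_one] using H (1 ⊗ₜ w)

variable (B) in
/-- The extension along `A → B` of an endomorphism of `A ⊗ W`. -/
def vecExtend (g : A ⊗[F] W →ₗ[A] A ⊗[F] W) : B ⊗[F] W →ₗ[B] B ⊗[F] W :=
  LinearMap.liftBaseChange B
    ((vecMap W A B).restrictScalars F ∘ₗ g.restrictScalars F ∘ₗ TensorProduct.mk F A W 1)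

theorem vecExtend_vecMap (g : A ⊗[F] W →ₗ[A] A ⊗[F] W) (x : A ⊗[F] W) :
    vecExtend B g (vecMap W A B x) = vecMap W A B (g x) := by
  induction x using TensorProduct.induction_on with
  | zero => simp
  | add x y hx hy => simp only [map_add, hx, hy]
  | tmul a w =>
    have h : (a ⊗ₜ[F] w : A ⊗[F] W) = a • (1 ⊗ₜ[F] w) := by
      simp [TensorProduct.smul_tmul']
    rw [h, map_smul g, map_smul (vecMap W A B), map_smul (vecMap W A B),
      LinearMap.map_smul_of_tower, vecMap_one]
    congr 1
    simp [vecExtend]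

theorem vecExtend_comp (g h : A ⊗[F] W →ₗ[A] A ⊗[F] W) :
    vecExtend B g ∘ₗ vecExtend B h = vecExtend B (g ∘ₗ h) :=
  vec_ext (A := A) fun x => by
    simp only [LinearMap.comp_apply, vecExtend_vecMap]

theorem vecExtend_id : vecExtend B (LinearMap.id : A ⊗[F] W →ₗ[A] A ⊗[F] W) = LinearMap.id :=
  vec_ext (A := A) fun x => by
    simp only [LinearMap.id_apply, vecExtend_vecMap]

variable (B) in
/-- The homomorphism `GL(W)(A) → GL(W)(B)`. -/
def glExtend (g : (A ⊗[F] W) ≃ₗ[A] (A ⊗[F] W)) : (B ⊗[F] W) ≃ₗ[B] (B ⊗[F] W) :=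
  LinearEquiv.ofLinearMap (vecExtend B g.toLinearMap) (vecExtend B g.symm.toLinearMap)
    (by rw [vecExtend_comp, LinearEquiv.comp_symm, vecExtend_id])
    (by rw [vecExtend_comp, LinearEquiv.symm_comp, vecExtend_id])

theorem glExtend_vecMap (g : (A ⊗[F] W) ≃ₗ[A] (A ⊗[F] W)) (x : A ⊗[F] W) :
    glExtend B g (vecMap W A B x) = vecMap W A B (g x) :=
  vecExtend_vecMap g.toLinearMap x

theorem tensorProductEnd_tmul (a b : A) (e : Module.End F W) (w : W) :
    LinearMap.tensorProductEnd F A W (a ⊗ₜ[F] e) (b ⊗ₜ[F] w) = (a * b) ⊗ₜ[F] e w := by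
  change (a • LinearMap.baseChange A e) (b ⊗ₜ[F] w) = _
  simp [TensorProduct.smul_tmul']

theorem tensorProductEnd_vecMap (x : A ⊗[F] Module.End F W) (w : A ⊗[F] W) :
    LinearMap.tensorProductEnd F B W (endMap (IsScalarTower.toAlgHom F A B) x)
      (vecMap W A B w) = vecMap W A B (LinearMap.tensorProductEnd F A W x w) := by
  induction x using TensorProduct.induction_on with
  | zero => simp
  | add x y hx hy => simp only [map_add, LinearMap.add_apply, hx, hy]
  | tmul a e =>
    induction w using TensorProduct.induction_on with
    | zero => simp
    | add x y hx hy => simp only [map_add, hx, hy]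
    | tmul b w =>
      rw [tensorProductEnd_tmul]
      have h (c : A) (v : W) : vecMap W A B (c ⊗ₜ[F] v) = algebraMap A B c ⊗ₜ[F] v := by
        simp [vecMap]
      rw [h, h, Algebra.TensorProduct.map_tmul, tensorProductEnd_tmul, map_mul]
      rfl

theorem IsClassOf.extend {φ : PGLPoints F W A} {g : (A ⊗[F] W) ≃ₗ[A] (A ⊗[F] W)}
    (h : IsClassOf φ g) :
    IsClassOf (pglMap (IsScalarTower.toAlgHom F A B) φ) (glExtend B g) := by
  have key : ∀ e : Module.End F W,
      LinearMap.tensorProductEnd F B W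
          (pglMap (IsScalarTower.toAlgHom F A B) φ (1 ⊗ₜ[F] e)) ∘ₗ (glExtend B g).toLinearMap =
        (glExtend B g).toLinearMap ∘ₗ LinearMap.tensorProductEnd F B W (1 ⊗ₜ[F] e) := fun e =>
    vec_ext (A := A) fun w => by
      have he : (1 ⊗ₜ[F] e : B ⊗[F] Module.End F W) =
          endMap (IsScalarTower.toAlgHom F A B) (1 ⊗ₜ[F] e) := by simp
      rw [LinearMap.comp_apply, LinearMap.comp_apply, LinearEquiv.coe_coe,
        he, pglMap_endMap, glExtend_vecMap, tensorProductEnd_vecMap, tensorProductEnd_vecMap,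
        glExtend_vecMap, h]
  intro x w
  induction x using TensorProduct.induction_on with
  | zero => simp
  | add x y hx hy => simp only [map_add, LinearMap.add_apply, hx, hy]
  | tmul b e =>
    have hb : (b ⊗ₜ[F] e : B ⊗[F] Module.End F W) = b • (1 ⊗ₜ[F] e) := by
      simp [TensorProduct.smul_tmul']
    have := LinearMap.congr_fun (key e) w
    rw [LinearMap.comp_apply, LinearMap.comp_apply, LinearEquiv.coe_coe] at this
    rw [hb, map_smul (pglMap (IsScalarTower.toAlgHom F A B) φ),
      map_smul (LinearMap.tensorProductEnd F B W), map_smul (LinearMap.tensorProductEnd F B W),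
      LinearMap.smul_apply, LinearMap.smul_apply, map_smul (glExtend B g), this]

theorem extendScalars_tower :
    extendScalars n B L = Submodule.span B
      (dividedPowerMap (B := B) n (vecMap W A B) ''
        (extendScalars n A L : Set (DividedPower A n (A ⊗[F] W)))) := by
  have hcomp (t : DividedPower F n W) :
      dividedPowerMap (B := B) n (TensorProduct.mk F B W 1) t =
        dividedPowerMap (B := B) n (vecMap W A B)
          (dividedPowerMap (B := A) n (TensorProduct.mk F A W 1) t) := by
    rw [dividedPowerMap_comp]
    congr 2
    ext w
    simp [vecMap_one]
  apply le_antisymm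
  · refine Submodule.span_le.2 ?_
    rintro _ ⟨t, ht, rfl⟩
    exact Submodule.subset_span ⟨_, Submodule.subset_span ⟨t, ht, rfl⟩, (hcomp t).symm⟩
  · refine Submodule.span_le.2 ?_
    rintro _ ⟨t, ht, rfl⟩
    have hle : extendScalars n A L ≤ ((extendScalars n B L).restrictScalars A).comap
        (dividedPowerMap (B := B) n (vecMap W A B)) := by
      refine Submodule.span_le.2 ?_
      rintro _ ⟨t, ht, rfl⟩
      exact Submodule.subset_span ⟨t, ht, hcomp t⟩
    exact hle ht

theorem Stabilizes.extend_le {g : (A ⊗[F] W) ≃ₗ[A] (A ⊗[F] W)} (h : Stabilizes L g) :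
    (extendScalars n B L).map (dividedPowerMap (B := B) n (glExtend B g).toLinearMap) ≤
      extendScalars n B L := by
  conv_lhs => rw [extendScalars_tower (A := A)]
  rw [Submodule.map_span_le]
  rintro _ ⟨t, ht, rfl⟩
  have hcomm : dividedPowerMap (B := B) n (glExtend B g).toLinearMap
      (dividedPowerMap (B := B) n (vecMap W A B) t) =
      dividedPowerMap (B := B) n (vecMap W A B)
        (dividedPowerMap (B := A) n g.toLinearMap t) := by
    rw [dividedPowerMap_comp, dividedPowerMap_comp]
    congr 2
    exact LinearMap.ext fun x => glExtend_vecMap g x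
  rw [hcomm, extendScalars_tower (A := A)]
  refine Submodule.subset_span ⟨_, ?_, rfl⟩
  rw [SetLike.mem_coe, ← h]
  exact Submodule.mem_map_of_mem ht

theorem Stabilizes.extend {g : (A ⊗[F] W) ≃ₗ[A] (A ⊗[F] W)} (h : Stabilizes L g) :
    Stabilizes L (glExtend B g) := by
  refine le_antisymm h.extend_le ?_
  have h1 := Submodule.map_mono
    (f := dividedPowerMap (B := B) n (glExtend B g).toLinearMap) (h.inv.extend_le (B := B))
  rw [← Submodule.map_comp, ← dividedPowerMap_trans] at h1
  have h2 : (glExtend B g.symm).trans (glExtend B g) = LinearEquiv.refl B _ := by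
    apply LinearEquiv.toLinearMap_injective
    change vecExtend B g.toLinearMap ∘ₗ vecExtend B g.symm.toLinearMap = LinearMap.id
    rw [vecExtend_comp, LinearEquiv.comp_symm, vecExtend_id]
  rw [h2] at h1
  have h3 := Stabilizes.one (L := L) (A := B)
  rw [Stabilizes] at h3
  rwa [h3] at h1

end Stab

/-- The group `Stab_{PGL(W)}(L)(A)` of the elements of `PGL(W)(A)` that fix the `A`-point `L_A` of
the Grassmannian of `Γⁿ(W)`. An element of `PGL(W)(A)` comes from an element `g` of `GL(W)` only
after a faithfully flat extension `A → B`, and it fixes `L_A` if and only if `g(L_B) = L_B`. -/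
def stabPoints {n : ℕ} (L : Submodule F (DividedPower F n W)) (A : Type u) [CommRing A]
    [Algebra F A] : Subgroup (PGLPoints F W A) where
  carrier := {φ | ∃ (B : Type u) (_ : CommRing B) (_ : Algebra F B) (_ : Algebra A B)
    (_ : IsScalarTower F A B), Module.FaithfullyFlat A B ∧
      ∃ g : (B ⊗[F] W) ≃ₗ[B] (B ⊗[F] W),
        IsClassOf (pglMap (IsScalarTower.toAlgHom F A B) φ) g ∧ Stabilizes L g}
  one_mem' := ⟨A, _, _, Algebra.id A, inferInstance, inferInstance, LinearEquiv.refl A _, by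
    rw [map_one]
    exact IsClassOf.one, Stabilizes.one⟩
  inv_mem' := by
    rintro φ ⟨B, _, _, _, _, hB, g, h1, h2⟩
    refine ⟨B, _, _, _, inferInstance, hB, g.symm, ?_, h2.inv⟩
    rw [map_inv]
    exact h1.inv
  mul_mem' := by
    rintro φ ψ ⟨B, _, _, _, _, hB, g, h1, h2⟩ ⟨C, _, _, _, _, hC, h, h3, h4⟩
    let D := B ⊗[A] C
    let aC : Algebra C D := Algebra.TensorProduct.rightAlgebra
    have : IsScalarTower F C D := IsScalarTower.of_algebraMap_eq fun r => by
      change algebraMap F D r = (1 : B) ⊗ₜ[A] algebraMap F C r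
      rw [IsScalarTower.algebraMap_apply F A D, IsScalarTower.algebraMap_apply F A C]
      exact (Algebra.TensorProduct.includeRight : C →ₐ[A] D).commutes _ |>.symm
    have hD : Module.FaithfullyFlat A D := Module.FaithfullyFlat.trans A B D
    refine ⟨D, inferInstance, inferInstance, inferInstance, inferInstance, hD,
      (glExtend D h).trans (glExtend D g), ?_, h2.extend.mul h4.extend⟩
    have e1 : IsScalarTower.toAlgHom F A D =
        (IsScalarTower.toAlgHom F B D).comp (IsScalarTower.toAlgHom F A B) :=
      AlgHom.ext fun a => IsScalarTower.algebraMap_apply A B D a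
    have e2 : IsScalarTower.toAlgHom F A D =
        (IsScalarTower.toAlgHom F C D).comp (IsScalarTower.toAlgHom F A C) :=
      AlgHom.ext fun a => ((Algebra.TensorProduct.includeRight : C →ₐ[A] D).commutes a).symm
    have k1 : IsClassOf (pglMap (IsScalarTower.toAlgHom F A D) φ) (glExtend D g) := by
      rw [e1, pglMap_comp]
      exact h1.extend
    have k2 : IsClassOf (pglMap (IsScalarTower.toAlgHom F A D) ψ) (glExtend D h) := by
      rw [e2, pglMap_comp]
      exact h3.extend
    rw [map_mul]
    exact k1.mul k2

theorem pglMap_mem_stabPoints {n : ℕ} (L : Submodule F (DividedPower F n W)) (f : A →ₐ[F] C)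
    {φ : PGLPoints F W A} (hφ : φ ∈ stabPoints L A) : pglMap f φ ∈ stabPoints L C := by
  obtain ⟨B, _, _, _, _, hB, g, h1, h2⟩ := hφ
  let _ : Algebra A C := f.toRingHom.toAlgebra
  have : IsScalarTower F A C := IsScalarTower.of_algebraMap_eq fun r => (f.commutes r).symm
  let D := C ⊗[A] B
  let aB : Algebra B D := Algebra.TensorProduct.rightAlgebra
  have : IsScalarTower F B D := IsScalarTower.of_algebraMap_eq fun r => by
    change algebraMap F D r = (1 : C) ⊗ₜ[A] algebraMap F B r
    rw [IsScalarTower.algebraMap_apply F A D, IsScalarTower.algebraMap_apply F A B]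
    exact (Algebra.TensorProduct.includeRight : B →ₐ[A] D).commutes _ |>.symm
  refine ⟨D, inferInstance, inferInstance, inferInstance, inferInstance, inferInstance,
    glExtend D g, ?_, h2.extend⟩
  have e : (IsScalarTower.toAlgHom F C D).comp f =
      (IsScalarTower.toAlgHom F B D).comp (IsScalarTower.toAlgHom F A B) :=
    AlgHom.ext fun a => ((Algebra.TensorProduct.includeRight : B →ₐ[A] D).commutes a).symm
  rw [← pglMap_comp, e, pglMap_comp]
  exact h1.extend

/-- The group functor `Stab_{PGL(W)}(L)` on commutative `F`-algebras. -/
def stabFunctor {n : ℕ} (L : Submodule F (DividedPower F n W)) :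
    CommAlgCat.{u} F ⥤ GrpCat.{u} where
  obj A := GrpCat.of (stabPoints L A)
  map {A C} f := GrpCat.ofHom
    (((pglMap f.hom).comp (stabPoints L A).subtype).codRestrict (stabPoints L C)
      fun φ => pglMap_mem_stabPoints L f.hom φ.2)
  map_id A := by
    apply GrpCat.hom_ext
    refine MonoidHom.ext fun φ => ?_
    exact Subtype.ext (pglMap_id φ.1)
  map_comp f g := by
    apply GrpCat.hom_ext
    refine MonoidHom.ext fun φ => ?_
    exact Subtype.ext (pglMap_comp g.hom f.hom φ.1)

end PGL

/-- The functor of points `A ↦ G(A) = Hom_F(Spec A, G)` of a group scheme `G` over `F`, on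
commutative `F`-algebras. -/
def pointsFunctor (F : Type u) [Field F] (G : Over (Spec (CommRingCat.of F))) [GrpObj G] :
    CommAlgCat.{u} F ⥤ GrpCat.{u} :=
  (algSpec (CommRingCat.of F)).rightOp ⋙ yonedaGrpObj G

section Veronese

variable (K : Type*) [Field K] (n : ℕ) (V : Type*) [AddCommGroup V] [Module K V]

variable {V} in
theorem pureSymbol_ne_zero {v : V} (hv : v ≠ 0) : pureSymbol K n v ≠ 0 := by
  obtain ⟨f, hf⟩ := Module.Projective.exists_dual_ne_zero K hv
  intro h
  have h0 : PiTensorProduct.tprod K (fun _ : Fin n => v) = 0 := congrArg Subtype.val h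
  have h1 := congrArg (PiTensorProduct.lift
    ((MultilinearMap.mkPiAlgebra K (Fin n) K).compLinearMap fun _ => f)) h0
  rw [PiTensorProduct.lift.tprod, map_zero] at h1
  simp at h1
  exact hf h1.1

variable {V} in
theorem pureSymbol_smul (c : K) (v : V) : pureSymbol K n (c • v) = c ^ n • pureSymbol K n v := by
  apply Subtype.ext
  change PiTensorProduct.tprod K (fun _ : Fin n => c • v) =
    c ^ n • PiTensorProduct.tprod K (fun _ : Fin n => v)
  have h := (PiTensorProduct.tprod K (s := fun _ : Fin n => V)).map_smul_univ
    (fun _ => c) (fun _ => v)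
  simpa using h

/-- The Veronese map `Ver_n : ℙ(V)(K) → ℙ(Γⁿ(V))(K)`, `(v) ↦ ([v]ₙ)`, on points over a field. -/
def veronese : ℙ K V → ℙ K (DividedPower K n V) :=
  Projectivization.lift
    (fun v => Projectivization.mk K (pureSymbol K n v.1) (pureSymbol_ne_zero K n v.2))
    fun v w c h => by
      rw [Projectivization.mk_eq_mk_iff']
      exact ⟨c ^ n, by rw [← pureSymbol_smul, h]⟩

variable {K n V} in
/-- The set of points of `ℙ(E)` inside `ℙ(Γⁿ(V))`, for a linear subspace `E` of `Γⁿ(V)`: the lines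
contained in `E`. -/
def linesIn (E : Submodule K (DividedPower K n V)) : Set (ℙ K (DividedPower K n V)) :=
  {p | p.submodule ≤ E}

end Veronese

end DividedTannaka

end

/-! Write the group as a closed subgroup of `GL_ι`, by a matrix `z` of functions generating the
coordinate ring `O`, and let it act on `W = F ⊕ Mat_ι` by `(t, Z) ↦ (t, gZ)`. A homogeneous
polynomial of degree `n` on `W` is a linear form on `Γⁿ(W)`. So a space `I` of such polynomials has
an annihilator `L`, and since `I` is in turn the annihilator of `L`, an element `g` fixes `L`
exactly when `f ↦ f ∘ g` preserves `I`. It remains to find an `I` whose symmetries are the group and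
the scalars.

The space `I` consists of the `f` satisfying conditions on the coefficients of `f(t, r)` as a
polynomial in `t`. Disjoint sets of exponents serve separate purposes: `low` makes `g` preserve the
line `F ⊕ 0`; `n - 1` makes it preserve `0 ⊕ Mat_ι`; one slot for each basis vector `e_j` and for
`(1, …, 1)` makes it preserve the matrices `v ⊗ e_j` and `v ⊗ (1, …, 1)`, hence act by a left
multiplication `H`, up to a scalar; and a window of `d + 1` exponents carries the homogenized
equations of the group, which puts `H` in it. Each condition is invariant under left multiplication
by the group. The recognition steps are `apply_some_none_eq_zero`, `apply_none_some_eq_zero`,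
`eq_smul_leftMulMatrix` and `exists_eq_smul_leftMulMatrix`.

All conditions are tested over arbitrary algebras, so the argument applies to points over any ring
and needs no reducedness. An element of `PGL(W)(A)` lifts to a linear map only over a faithfully
flat `B`; the matrix `H` found there is read off from the element of `PGL(W)` itself (`readEntry`)
and so has entries in `A` (`exists_toPGL_eq`). Every power `x_j ^ n` of a coordinate lies in `I`, so
no nonzero pure symbol lies in `L`. -/

noncomputable section

namespace DividedTannaka

/-! ### Annihilators of coordinate spaces and their base change -/

section Annihilators

variable {F : Type*} [Field F] {C : Type*} [Fintype C]

/-- The annihilator of a space of coordinate vectors for the standard pairing. -/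
def perp (I : Submodule F (C → F)) : Submodule F (C → F) where
  carrier := {τ | ∀ a ∈ I, ∑ c, a c * τ c = 0}
  zero_mem' := fun a _ => by simp
  add_mem' := fun {s t} hs ht a ha => by
    simp only [Pi.add_apply, mul_add, Finset.sum_add_distrib, hs a ha, ht a ha, add_zero]
  smul_mem' := fun r t ht a ha => by
    simp only [Pi.smul_apply, smul_eq_mul, mul_left_comm _ r, ← Finset.mul_sum, ht a ha, mul_zero]

/-- A vector outside `I` is separated from it by a functional, and every functional on `C → F` is
the pairing with a vector. -/
theorem perp_perp (I : Submodule F (C → F)) : perp (perp I) = I := by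
  classical
  apply le_antisymm
  · intro a ha
    by_contra hI
    obtain ⟨φ, hφ, hφI⟩ := Submodule.exists_le_ker_of_notMem hI
    have hφ' (x : C → F) : φ x = ∑ c, φ (Pi.single c 1) * x c := by
      conv_lhs => rw [pi_eq_sum_univ' x]
      simp [mul_comm]
    apply hφ
    rw [hφ']
    refine ha _ fun x hx => ?_
    have : φ x = 0 := hφI hx
    rw [hφ'] at this
    simpa only [mul_comm] using this
  · intro a ha τ hτ
    have := hτ a ha
    simpa only [mul_comm] using this

variable (B : Type*) [CommRing B] [Algebra F B]

/-- The space of vectors over `B` spanned by a space of vectors over `F`. -/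
def spanVec (I : Submodule F (C → F)) : Submodule B (C → B) :=
  Submodule.span B ((fun (x : C → F) c => algebraMap F B (x c)) '' I)

variable {B}

/-- Over a basis of `B` over `F`, a vector is a finite combination of its components, which have
entries in `F`. This replaces flatness of `B` in what follows. -/
theorem mem_spanVec_of_repr {κ : Type*} (b : Module.Basis κ F B) {I : Submodule F (C → F)}
    {a : C → B} (h : ∀ k, (fun c => b.repr (a c) k) ∈ I) : a ∈ spanVec B I := by
  classical
  let T : Finset κ := Finset.univ.biUnion fun c => (b.repr (a c)).support
  have ha : a = ∑ k ∈ T, b k • fun c => algebraMap F B (b.repr (a c) k) := by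
    ext c
    rw [Finset.sum_apply]
    conv_lhs => rw [← b.linearCombination_repr (a c)]
    rw [Finsupp.linearCombination_apply, Finsupp.sum_of_support_subset (s := T)]
    · refine Finset.sum_congr rfl fun k _ => ?_
      rw [Pi.smul_apply, smul_eq_mul, Algebra.smul_def, mul_comm]
    · exact Finset.subset_biUnion_of_mem (fun c => (b.repr (a c)).support) (Finset.mem_univ c)
    · simp
  rw [ha]
  exact Submodule.sum_mem _ fun k _ =>
    Submodule.smul_mem _ _ (Submodule.subset_span ⟨_, h k, rfl⟩)

theorem sum_eq_zero_of_mem_spanVec {I : Submodule F (C → F)} {a : C → B} (ha : a ∈ spanVec B I)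
    {τ : C → F} (hτ : τ ∈ perp I) : ∑ c, a c * algebraMap F B (τ c) = 0 := by
  induction ha using Submodule.span_induction with
  | mem x hx =>
    obtain ⟨y, hy, rfl⟩ := hx
    simp only [← map_mul, ← map_sum, hτ y hy, map_zero]
  | zero => simp
  | add x y _ _ hx hy => simp only [Pi.add_apply, add_mul, Finset.sum_add_distrib, hx, hy, add_zero]
  | smul r x _ hx =>
    simp only [Pi.smul_apply, smul_eq_mul, mul_assoc, ← Finset.mul_sum, hx, mul_zero]

theorem mem_spanVec_of_forall_perp {I : Submodule F (C → F)} {a : C → B}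
    (h : ∀ τ ∈ perp I, ∑ c, a c * algebraMap F B (τ c) = 0) : a ∈ spanVec B I := by
  let b := Module.Basis.ofVectorSpace F B
  refine mem_spanVec_of_repr b fun k => ?_
  rw [← perp_perp I]
  intro τ hτ
  have := congrArg (fun y => b.repr y k) (h τ hτ)
  simpa [← Algebra.commutes, ← Algebra.smul_def] using this

/-- Two vectors over `B` pair to zero if one lies in the span of `I` and the other in the span
of its annihilator. -/
theorem sum_eq_zero_of_mem_spanVec_perp {I : Submodule F (C → F)} {a τ : C → B}
    (ha : a ∈ spanVec B I) (hτ : τ ∈ spanVec B (perp I)) : ∑ c, a c * τ c = 0 := by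
  induction hτ using Submodule.span_induction with
  | mem x hx =>
    obtain ⟨y, hy, rfl⟩ := hx
    exact sum_eq_zero_of_mem_spanVec ha hy
  | zero => simp
  | add x y _ _ hx hy => simp only [Pi.add_apply, mul_add, Finset.sum_add_distrib, hx, hy, add_zero]
  | smul r x _ hx =>
    simp only [Pi.smul_apply, smul_eq_mul, mul_left_comm _ r, ← Finset.mul_sum, hx, mul_zero]

theorem mem_spanVec_iff_forall_spanVec_perp {I : Submodule F (C → F)} {a : C → B} :
    a ∈ spanVec B I ↔ ∀ τ ∈ spanVec B (perp I), ∑ c, a c * τ c = 0 :=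
  ⟨fun ha _ hτ => sum_eq_zero_of_mem_spanVec_perp ha hτ, fun h => mem_spanVec_of_forall_perp
    fun τ hτ => h _ (Submodule.subset_span ⟨τ, hτ, rfl⟩)⟩

theorem mem_spanVec_perp_iff {I : Submodule F (C → F)} {τ : C → B} :
    τ ∈ spanVec B (perp I) ↔ ∀ a ∈ spanVec B I, ∑ c, a c * τ c = 0 := by
  rw [mem_spanVec_iff_forall_spanVec_perp, perp_perp]
  simp only [mul_comm]

end Annihilators

/-! ### Coordinates on tensor powers -/

section Coordinates

variable {J : Type*} [Fintype J] (n : ℕ)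
variable {R M : Type*} [CommRing R] [AddCommGroup M] [Module R M]

/-- The coordinates of a tensor of degree `n`. -/
def tensorCoord (b : Module.Basis J R M) : (⨂[R]^n M) ≃ₗ[R] ((Fin n → J) → R) :=
  (Basis.piTensorProduct fun _ : Fin n => b).equivFun

theorem tensorCoord_tprod (b : Module.Basis J R M) (v : Fin n → M) (c : Fin n → J) :
    tensorCoord n b (PiTensorProduct.tprod R v) c = ∏ i, b.repr (v i) (c i) := by
  simp [tensorCoord]

theorem tensorCoord_reindex (b : Module.Basis J R M) (σ : Equiv.Perm (Fin n)) (t : ⨂[R]^n M)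
    (c : Fin n → J) :
    tensorCoord n b (PiTensorProduct.reindex R (fun _ => M) σ t) c =
      tensorCoord n b t (c ∘ σ) := by
  induction t using PiTensorProduct.induction_on with
  | smul_tprod r m =>
    have h := (PiTensorProduct.reindex R (fun _ : Fin n => M) σ).map_smul r
      (PiTensorProduct.tprod R m)
    refine (congrArg (fun y => tensorCoord n b y c) h).trans ?_
    rw [map_smul, reindex_tprod_const, map_smul, Pi.smul_apply, Pi.smul_apply, tensorCoord_tprod,
      tensorCoord_tprod, ← Equiv.prod_comp σ]
    refine congrArg (r • ·) (Finset.prod_congr rfl fun i _ => ?_)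
    exact congrArg (fun k => b.repr (m k) (c (σ i))) (σ.symm_apply_apply i)
  | add x y hx hy =>
    have h := (PiTensorProduct.reindex R (fun _ : Fin n => M) σ).map_add x y
    refine (congrArg (fun y => tensorCoord n b y c) h).trans ?_
    rw [map_add, map_add, Pi.add_apply, Pi.add_apply]
    exact congrArg₂ (· + ·) hx hy

variable {S N : Type*} [CommRing S] [Algebra R S] [AddCommGroup N] [Module S N] [Module R N]
  [IsScalarTower R S N]

theorem tensorCoord_tensorPowerMap (b : Module.Basis J R M) (b' : Module.Basis J S N)
    (f : M →ₗ[R] N) (t : ⨂[R]^n M) (c : Fin n → J) :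
    tensorCoord n b' (tensorPowerMap n f t) c =
      ∑ c', (∏ i, b'.repr (f (b (c' i))) (c i)) * algebraMap R S (tensorCoord n b t c') := by
  have ht : t = ∑ c', tensorCoord n b t c' • PiTensorProduct.tprod R fun i => b (c' i) := by
    conv_lhs => rw [← (Basis.piTensorProduct fun _ : Fin n => b).sum_equivFun t]
    simp [tensorCoord]
  conv_lhs => rw [ht]
  rw [map_sum, map_sum, Finset.sum_apply]
  refine Finset.sum_congr rfl fun c' _ => ?_
  rw [map_smul, tensorPowerMap_tprod, ← algebraMap_smul S (tensorCoord n b t c'), map_smul,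
    Pi.smul_apply, tensorCoord_tprod, smul_eq_mul, mul_comm]

end Coordinates

section StandardBasis

variable (F : Type*) [Field F] (J : Type*) [Fintype J] (B : Type*) [CommRing B] [Algebra F B]

/-- The basis of `B ⊗ F^J` given by the standard basis of `F^J`. -/
def stdBasis : Module.Basis J B (B ⊗[F] (J → F)) := (Pi.basisFun F J).baseChange B

variable {F J B}

theorem stdBasis_apply [DecidableEq J] (j : J) : stdBasis F J B j = 1 ⊗ₜ Pi.single j 1 := by
  simp [stdBasis]

theorem stdBasis_repr_tmul (b : B) (w : J → F) (j : J) :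
    (stdBasis F J B).repr (b ⊗ₜ w) j = algebraMap F B (w j) * b := by
  simp [stdBasis, Algebra.smul_def]

end StandardBasis

/-! ### Homogeneous polynomials as linear forms on tensors -/

section TensorPolynomials

open MvPolynomial

variable {J : Type*} [Fintype J] {n : ℕ} {B : Type*} [CommRing B]

/-- The homogeneous polynomial with (non-commutative) coefficients `a`. -/
def tensorPoly (a : (Fin n → J) → B) : MvPolynomial J B := ∑ c, C (a c) * ∏ i, X (c i)

theorem tensorPoly_add (a a' : (Fin n → J) → B) :
    tensorPoly (a + a') = tensorPoly a + tensorPoly a' := by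
  simp [tensorPoly, add_mul, Finset.sum_add_distrib]

theorem tensorPoly_smul (r : B) (a : (Fin n → J) → B) :
    tensorPoly (r • a) = C r * tensorPoly a := by
  simp [tensorPoly, Finset.mul_sum, mul_assoc]

theorem tensorPoly_single [DecidableEq J] (c : Fin n → J) :
    tensorPoly (Pi.single c (1 : B)) = ∏ i, X (c i) := by
  rw [tensorPoly, Finset.sum_eq_single c (fun c' _ h => by simp [h]) (by simp)]
  simp

theorem aeval_tensorPoly {R : Type*} [CommRing R] [Algebra B R] (w : J → R)
    (a : (Fin n → J) → B) :
    aeval w (tensorPoly a) = ∑ c, algebraMap B R (a c) * ∏ i, w (c i) := by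
  simp [tensorPoly, map_sum]

/-- A monomial of degree `n` becomes a word of length `n` once its variables are listed in some
order. The coefficient vector is far from unique; the redundancy is exactly what later forces
annihilators to be symmetric. -/
theorem exists_tensorPoly_eq {f : MvPolynomial J B} (hf : f.IsHomogeneous n) :
    ∃ a : (Fin n → J) → B, tensorPoly a = f := by
  classical
  let T : Submodule B (MvPolynomial J B) :=
    { carrier := Set.range (tensorPoly (n := n))
      zero_mem' := ⟨0, by simp [tensorPoly]⟩
      add_mem' := by
        rintro _ _ ⟨a, rfl⟩ ⟨a', rfl⟩
        exact ⟨a + a', tensorPoly_add a a'⟩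
      smul_mem' := by
        rintro r _ ⟨a, rfl⟩
        exact ⟨r • a, by rw [tensorPoly_smul, smul_eq_C_mul]⟩ }
  change f ∈ T
  rw [f.as_sum]
  refine Submodule.sum_mem _ fun d hd => ?_
  have hdeg : d.degree = n := by
    rw [Finsupp.degree_eq_weight_one]
    exact hf (mem_support_iff.1 hd)
  rw [show monomial d (coeff d f) = coeff d f • monomial d (1 : B) by
    rw [smul_monomial, smul_eq_mul, mul_one]]
  refine Submodule.smul_mem _ _ ?_
  have hcard : (Finsupp.toMultiset d).toList.length = n := by
    rw [Multiset.length_toList, Finsupp.card_toMultiset, ← hdeg]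
    rfl
  refine ⟨Pi.single (fun i => (Finsupp.toMultiset d).toList.get (Fin.cast hcard.symm i)) 1, ?_⟩
  rw [tensorPoly_single]
  set l := (Finsupp.toMultiset d).toList with hl
  calc ∏ i : Fin n, (X (l.get (Fin.cast hcard.symm i)) : MvPolynomial J B)
      = ∏ i : Fin l.length, X (l.get i) :=
        Fintype.prod_equiv (finCongr hcard.symm) _ _ fun i => rfl
    _ = (l.map X).prod := by
        rw [← List.prod_ofFn]
        congr 1
        apply List.ext_getElem <;> simp
    _ = ((Finsupp.toMultiset d).map X).prod := by
        rw [← Multiset.prod_map_toList]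
    _ = monomial d 1 := by
        rw [monomial_eq, Finsupp.toMultiset_map, Finsupp.prod_toMultiset,
          Finsupp.prod_mapDomain_index (by simp) (by simp [pow_add]), C_1, one_mul]

theorem tensorPoly_isHomogeneous (a : (Fin n → J) → B) : (tensorPoly a).IsHomogeneous n := by
  refine IsHomogeneous.sum _ _ _ fun c _ => ?_
  have := (isHomogeneous_C J (a c)).mul
    (IsHomogeneous.prod Finset.univ (fun i => X (c i)) (fun _ => 1) fun i _ =>
      isHomogeneous_X B (c i))
  simpa using this

/-- The polynomial `f ∘ γ` for a square matrix `γ`. -/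
def linSubst (γ : Matrix J J B) : MvPolynomial J B →ₐ[B] MvPolynomial J B :=
  aeval fun j => ∑ j', C (γ j j') * X j'

theorem linSubst_tensorPoly (γ : Matrix J J B) (a : (Fin n → J) → B) :
    linSubst γ (tensorPoly a) = tensorPoly fun c' => ∑ c, a c * ∏ i, γ (c i) (c' i) := by
  classical
  rw [linSubst, aeval_tensorPoly, tensorPoly]
  simp only [algebraMap_eq, Finset.prod_univ_sum, Fintype.piFinset_univ, map_sum, Finset.sum_mul,
    Finset.mul_sum]
  rw [Finset.sum_comm]
  refine Finset.sum_congr rfl fun c _ => Finset.sum_congr rfl fun c' _ => ?_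
  rw [map_mul, map_prod, Finset.prod_mul_distrib, mul_assoc]

theorem aeval_linSubst {R : Type*} [CommRing R] [Algebra B R] (γ : Matrix J J B) (w : J → R)
    (f : MvPolynomial J B) :
    aeval w (linSubst γ f) = aeval (fun j => ∑ j', algebraMap B R (γ j j') * w j') f := by
  rw [linSubst, ← AlgHom.comp_apply, comp_aeval]
  simp

theorem linSubst_isHomogeneous (γ : Matrix J J B) {f : MvPolynomial J B}
    (hf : f.IsHomogeneous n) : (linSubst γ f).IsHomogeneous n := by
  have := hf.aeval (fun j => ∑ j', C (γ j j') * X j') (n := 1) fun j =>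
    IsHomogeneous.sum _ _ _ fun j' _ => by
      simpa using (isHomogeneous_C J (γ j j')).mul (isHomogeneous_X B j')
  rwa [one_mul] at this

end TensorPolynomials

/-! ### Linear conditions on polynomials and their base change -/

section Tests

open MvPolynomial

/-- A linear condition on polynomials: the vanishing of a sum of coefficients of the value at a
point with coordinates in a polynomial ring. -/
structure Test (F : Type u) [Field F] (J : Type) where
  /-- The coordinate ring of the condition. -/
  R : Type u
  [ring : CommRing R]
  [alg : Algebra F R]
  /-- The point at which polynomials are evaluated. -/
  pt : J → Polynomial R
  /-- The exponents of the coefficients that are added. -/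
  exps : Finset ℕ

attribute [instance] Test.ring Test.alg

variable {F : Type u} [Field F] {J : Type} (T : Test F J) (𝒯 : Set (Test F J)) {n : ℕ}
variable {B : Type u} [CommRing B]

namespace Test

/-- The value of a test at a polynomial, over a ring with a point of the test. -/
def value {E : Type u} [CommRing E] [Algebra F E] [Algebra B E] (y : T.R →ₐ[F] E)
    (f : MvPolynomial J B) : E :=
  ∑ e ∈ T.exps, (aeval (fun j => (T.pt j).map (y : T.R →+* E)) f : Polynomial E).coeff e

/-- The value of a test at a product of variables. -/
def weight (c : Fin n → J) : T.R := ∑ e ∈ T.exps, (∏ i, T.pt (c i)).coeff e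

theorem value_tensorPoly [Fintype J] {E : Type u} [CommRing E] [Algebra F E] [Algebra B E]
    (y : T.R →ₐ[F] E) (a : (Fin n → J) → B) :
    T.value y (tensorPoly a) = ∑ c, algebraMap B E (a c) * y (T.weight c) := by
  simp only [value, aeval_tensorPoly, weight, Polynomial.finsetSum_coeff, map_sum, Finset.mul_sum]
  rw [Finset.sum_comm]
  refine Finset.sum_congr rfl fun c _ => Finset.sum_congr rfl fun e _ => ?_
  rw [← Polynomial.map_prod, Polynomial.algebraMap_apply, Polynomial.coeff_C_mul,
    Polynomial.coeff_map]
  rfl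

end Test

variable [Algebra F B]

/-- The polynomial `f` satisfies all conditions in `𝒯`, at all points over all algebras. -/
def Passes (f : MvPolynomial J B) : Prop :=
  ∀ T ∈ 𝒯, ∀ (E : Type u) [CommRing E] [Algebra F E] [Algebra B E] [IsScalarTower F B E]
    (y : T.R →ₐ[F] E), T.value y f = 0

variable (n) in
/-- The coefficient vectors over `F` of the polynomials that satisfy all conditions in `𝒯`. -/
def passing [Fintype J] : Submodule F ((Fin n → J) → F) where
  carrier := {a | ∀ T ∈ 𝒯, ∑ c, a c • T.weight c = 0}
  zero_mem' := fun T _ => by simp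
  add_mem' := fun {a a'} h h' T hT => by
    simp only [Pi.add_apply, add_smul, Finset.sum_add_distrib, h T hT, h' T hT, add_zero]
  smul_mem' := fun r a h T hT => by
    simp only [Pi.smul_apply, smul_assoc, ← Finset.smul_sum, h T hT, smul_zero]

/-- The conditions are linear over `F`, so their solutions over `B` are spanned by those over `F`,
although they are imposed at points over all `B`-algebras. -/
theorem passes_tensorPoly_iff [Fintype J] {a : (Fin n → J) → B} :
    Passes 𝒯 (tensorPoly a) ↔ a ∈ spanVec B (passing 𝒯 n) := by
  constructor
  · intro h
    let b := Module.Basis.ofVectorSpace F B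
    refine mem_spanVec_of_repr b fun k T hT => ?_
    -- This is the universal point over a `B`-algebra; taking components in the basis `b` returns
    -- the condition in `T.R`.
    have h1 := h T hT (B ⊗[F] T.R) Algebra.TensorProduct.includeRight
    rw [Test.value_tensorPoly] at h1
    have h2 := congrArg ((TensorProduct.lid F T.R).toLinearMap ∘ₗ (b.coord k).rTensor T.R) h1
    simp only [Algebra.TensorProduct.algebraMap_apply, Algebra.TensorProduct.includeRight_apply,
      Algebra.TensorProduct.tmul_mul_tmul, mul_one, one_mul, map_sum, map_zero] at h2
    simpa using h2
  · intro ha T hT E _ _ _ _ y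
    rw [Test.value_tensorPoly]
    induction ha using Submodule.span_induction with
    | mem x hx =>
      obtain ⟨x, hx, rfl⟩ := hx
      have := congrArg y (hx T hT)
      rw [map_sum, map_zero] at this
      simpa only [← IsScalarTower.algebraMap_apply, Algebra.smul_def, map_mul,
        AlgHom.commutes] using this
    | zero => simp
    | add x x' _ _ h h' =>
      simp only [Pi.add_apply, map_add, add_mul, Finset.sum_add_distrib, h, h', add_zero]
    | smul r x _ h =>
      simp only [Pi.smul_apply, smul_eq_mul, map_mul, mul_assoc, ← Finset.mul_sum, h, mul_zero]

end Tests

/-! ### The subspace of the divided power and its stabilizer -/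

section StabilizedSpace

open MvPolynomial

variable {F : Type u} [Field F] {J : Type} [Fintype J] (𝒯 : Set (Test F J)) (n : ℕ)

/-- The divided powers of degree `n` that are annihilated by the polynomials satisfying all
conditions in `𝒯`. -/
def testSpace : Submodule F (DividedPower F n (J → F)) :=
  (perp (passing 𝒯 n)).comap
    ((tensorCoord n (Pi.basisFun F J)).toLinearMap ∘ₗ (DividedPower F n (J → F)).subtype)

-- Two words that differ by a permutation give the same monomial, so their difference passes every
-- test. Hence tensors annihilating the passing vectors are symmetric, and nothing is lost by
-- intersecting with the divided power.
variable {𝒯 n} in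
theorem mem_dividedPower_of_mem_perp {t : ⨂[F]^n (J → F)}
    (ht : tensorCoord n (Pi.basisFun F J) t ∈ perp (passing 𝒯 n)) :
    t ∈ DividedPower F n (J → F) := by
  classical
  intro σ
  apply (tensorCoord n (Pi.basisFun F J)).injective
  ext c
  rw [tensorCoord_reindex]
  -- This coefficient vector represents the zero polynomial.
  have h : (Pi.single c 1 - Pi.single (c ∘ σ) 1 : (Fin n → J) → F) ∈ passing 𝒯 n := by
    intro T _
    have hw : T.weight (c ∘ σ) = T.weight c := by
      simp only [Test.weight, Function.comp_apply]
      rw [Equiv.prod_comp σ fun i => T.pt (c i)]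
    simp [sub_smul, Finset.sum_sub_distrib, Pi.single_apply, ite_smul, hw]
  have := ht _ h
  simp only [Pi.sub_apply, sub_mul, Finset.sum_sub_distrib, Pi.single_apply, ite_mul, one_mul,
    zero_mul, Finset.sum_ite_eq', Finset.mem_univ, if_true] at this
  exact (sub_eq_zero.1 this).symm

variable {B : Type u} [CommRing B] [Algebra F B]

theorem tensorCoord_dividedPowerMap_mk (t : DividedPower F n (J → F)) :
    tensorCoord n (stdBasis F J B)
        (dividedPowerMap (B := B) n (TensorProduct.mk F B (J → F) 1) t : ⨂[B]^n (B ⊗[F] (J → F))) =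
      fun c => algebraMap F B (tensorCoord n (Pi.basisFun F J) t c) := by
  classical
  ext c
  refine (tensorCoord_tensorPowerMap n (Pi.basisFun F J) (stdBasis F J B) _ _ c).trans ?_
  rw [Finset.sum_eq_single c]
  · simp [stdBasis_repr_tmul]
  · intro c' _ hc
    obtain ⟨i, hi⟩ := Function.ne_iff.1 hc
    rw [Finset.prod_eq_zero (Finset.mem_univ i), zero_mul]
    simp [stdBasis_repr_tmul, hi.symm]
  · simp

variable {n}

variable (F J B n) in
/-- The coordinates of a divided power of degree `n`. -/
def dividedCoord : DividedPower B n (B ⊗[F] (J → F)) →ₗ[B] ((Fin n → J) → B) :=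
  (tensorCoord n (stdBasis F J B)).toLinearMap ∘ₗ (DividedPower B n (B ⊗[F] (J → F))).subtype

theorem dividedCoord_injective : Function.Injective (dividedCoord F J n B) :=
  (tensorCoord n (stdBasis F J B)).injective.comp Subtype.val_injective

theorem map_dividedCoord_extendScalars :
    (extendScalars n B (testSpace 𝒯 n)).map (dividedCoord F J n B) =
      spanVec B (perp (passing 𝒯 n)) := by
  rw [extendScalars, Submodule.map_span, spanVec]
  congr 1
  ext a
  constructor
  · rintro ⟨_, ⟨s, hs, rfl⟩, rfl⟩
    exact ⟨_, hs, (tensorCoord_dividedPowerMap_mk n s).symm⟩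
  · rintro ⟨x, hx, rfl⟩
    have hs : tensorCoord n (Pi.basisFun F J) ((tensorCoord n (Pi.basisFun F J)).symm x) ∈
        perp (passing 𝒯 n) := by
      rwa [LinearEquiv.apply_symm_apply]
    refine ⟨_, ⟨⟨_, mem_dividedPower_of_mem_perp hs⟩, hs, rfl⟩, ?_⟩
    refine (tensorCoord_dividedPowerMap_mk n _).trans ?_
    simp only [LinearEquiv.apply_symm_apply]

theorem mem_extendScalars_testSpace {t : DividedPower B n (B ⊗[F] (J → F))} :
    t ∈ extendScalars n B (testSpace 𝒯 n) ↔
      dividedCoord F J n B t ∈ spanVec B (perp (passing 𝒯 n)) := by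
  rw [← map_dividedCoord_extendScalars]
  exact ⟨fun h => Submodule.mem_map_of_mem h,
    fun ⟨s, hs, hst⟩ => dividedCoord_injective hst ▸ hs⟩

/-- The matrix of an endomorphism of `B ⊗ F^J`. -/
def stdMatrix (g : B ⊗[F] (J → F) →ₗ[B] B ⊗[F] (J → F)) : Matrix J J B :=
  Matrix.of fun j j' => (stdBasis F J B).repr (g (stdBasis F J B j')) j

/-- The action of `g` on divided powers is transposed to substitution in polynomials; this is what
translates between stabilizing `L` and preserving `I`. -/
theorem sum_mul_dividedCoord_dividedPowerMap (g : B ⊗[F] (J → F) →ₗ[B] B ⊗[F] (J → F))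
    (a : (Fin n → J) → B) (t : DividedPower B n (B ⊗[F] (J → F))) :
    ∑ c, a c * dividedCoord F J n B (dividedPowerMap (B := B) n g t) c =
      ∑ c', (∑ c, a c * ∏ i, stdMatrix g (c i) (c' i)) * dividedCoord F J n B t c' := by
  have h (c) : dividedCoord F J n B (dividedPowerMap (B := B) n g t) c = _ :=
    tensorCoord_tensorPowerMap n (stdBasis F J B) (stdBasis F J B) g _ c
  simp only [h, Finset.mul_sum, Finset.sum_mul]
  rw [Finset.sum_comm]
  refine Finset.sum_congr rfl fun c' _ => Finset.sum_congr rfl fun c _ => ?_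
  simp only [stdMatrix, Matrix.of_apply, mul_assoc]
  rfl

/-- If `g` stabilizes the space attached to `𝒯`, substitution of `g` preserves the polynomials
that satisfy the conditions in `𝒯`. -/
theorem Stabilizes.passes_linSubst {g : (B ⊗[F] (J → F)) ≃ₗ[B] (B ⊗[F] (J → F))}
    (hg : Stabilizes (testSpace 𝒯 n) g) {f : MvPolynomial J B} (hf : f.IsHomogeneous n)
    (h : Passes 𝒯 f) : Passes 𝒯 (linSubst (stdMatrix g.toLinearMap) f) := by
  obtain ⟨a, rfl⟩ := exists_tensorPoly_eq hf
  rw [linSubst_tensorPoly, passes_tensorPoly_iff, mem_spanVec_iff_forall_spanVec_perp]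
  rw [passes_tensorPoly_iff] at h
  intro τ hτ
  rw [← map_dividedCoord_extendScalars] at hτ
  obtain ⟨t, ht, rfl⟩ := hτ
  rw [← sum_mul_dividedCoord_dividedPowerMap]
  refine sum_eq_zero_of_mem_spanVec_perp h ?_
  rw [← mem_extendScalars_testSpace]
  have := Submodule.mem_map_of_mem (f := dividedPowerMap (B := B) n g.toLinearMap) ht
  rwa [hg] at this

theorem dividedPowerMap_mem_extendScalars {g : B ⊗[F] (J → F) →ₗ[B] B ⊗[F] (J → F)}
    (hg : ∀ f : MvPolynomial J B, f.IsHomogeneous n → Passes 𝒯 f →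
      Passes 𝒯 (linSubst (stdMatrix g) f))
    {t : DividedPower B n (B ⊗[F] (J → F))} (ht : t ∈ extendScalars n B (testSpace 𝒯 n)) :
    dividedPowerMap (B := B) n g t ∈ extendScalars n B (testSpace 𝒯 n) := by
  rw [mem_extendScalars_testSpace] at ht ⊢
  rw [mem_spanVec_perp_iff]
  intro a ha
  rw [sum_mul_dividedCoord_dividedPowerMap]
  refine sum_eq_zero_of_mem_spanVec_perp ?_ ht
  rw [← passes_tensorPoly_iff, ← linSubst_tensorPoly]
  exact hg _ (tensorPoly_isHomogeneous a) ((passes_tensorPoly_iff 𝒯).2 ha)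

theorem stabilizes_testSpace {g : (B ⊗[F] (J → F)) ≃ₗ[B] (B ⊗[F] (J → F))}
    (hg : ∀ f : MvPolynomial J B, f.IsHomogeneous n → Passes 𝒯 f →
      Passes 𝒯 (linSubst (stdMatrix g.toLinearMap) f))
    (hg' : ∀ f : MvPolynomial J B, f.IsHomogeneous n → Passes 𝒯 f →
      Passes 𝒯 (linSubst (stdMatrix g.symm.toLinearMap) f)) :
    Stabilizes (testSpace 𝒯 n) g := by
  apply le_antisymm
  · rintro _ ⟨t, ht, rfl⟩
    exact dividedPowerMap_mem_extendScalars 𝒯 hg ht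
  · intro t ht
    refine ⟨_, dividedPowerMap_mem_extendScalars 𝒯 hg' ht, ?_⟩
    rw [← LinearMap.comp_apply, ← dividedPowerMap_trans, LinearEquiv.symm_trans_self]
    exact dividedPowerMap_refl t

/-- A pure symbol in the space attached to `𝒯` is a common zero of the polynomials that satisfy
the conditions in `𝒯`. -/
theorem aeval_eq_zero_of_pureSymbol_mem {w : B ⊗[F] (J → F)}
    (hw : pureSymbol B n w ∈ extendScalars n B (testSpace 𝒯 n)) {f : MvPolynomial J B}
    (hf : f.IsHomogeneous n) (h : Passes 𝒯 f) :
    aeval (fun j => (stdBasis F J B).repr w j) f = 0 := by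
  obtain ⟨a, rfl⟩ := exists_tensorPoly_eq hf
  rw [mem_extendScalars_testSpace] at hw
  rw [passes_tensorPoly_iff] at h
  have := sum_eq_zero_of_mem_spanVec_perp h hw
  rw [aeval_tensorPoly]
  simpa [dividedCoord, pureSymbol, tensorCoord_tprod] using this

theorem testSpace_ne_bot {f : MvPolynomial J F} (hf : f.IsHomogeneous n) (h : ¬ Passes 𝒯 f) :
    testSpace 𝒯 n ≠ ⊥ := by
  intro hbot
  apply h
  obtain ⟨a, rfl⟩ := exists_tensorPoly_eq hf
  rw [passes_tensorPoly_iff]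
  refine mem_spanVec_of_forall_perp fun τ hτ => ?_
  have hs : tensorCoord n (Pi.basisFun F J) ((tensorCoord n (Pi.basisFun F J)).symm τ) ∈
      perp (passing 𝒯 n) := by
    rwa [LinearEquiv.apply_symm_apply]
  have h0 : (⟨_, mem_dividedPower_of_mem_perp hs⟩ : DividedPower F n (J → F)) ∈
      testSpace 𝒯 n := hs
  rw [hbot, Submodule.mem_bot] at h0
  have h1 := congrArg Subtype.val h0
  have h2 : τ = 0 := (tensorCoord n (Pi.basisFun F J)).symm.map_eq_zero_iff.1 h1
  simp [h2]

end StabilizedSpace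

/-! ### The conditions that single out the group -/

section MatrixTests

open MvPolynomial

variable {ι : Type}

/-- The linear pencil `t ↦ (t, r)` with coordinates in a polynomial ring. -/
def pencilPoint {R : Type*} [CommRing R] (r : Matrix ι ι R) : Option (ι × ι) → Polynomial R :=
  fun j => j.elim Polynomial.X fun p => Polynomial.C (r p.1 p.2)

@[simp]
theorem pencilPoint_none {R : Type*} [CommRing R] (r : Matrix ι ι R) :
    pencilPoint r none = Polynomial.X := rfl

@[simp]
theorem pencilPoint_some {R : Type*} [CommRing R] (r : Matrix ι ι R) (p : ι × ι) :
    pencilPoint r (some p) = Polynomial.C (r p.1 p.2) := rfl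

theorem map_pencilPoint {R S : Type*} [CommRing R] [CommRing S] (φ : R →+* S) (r : Matrix ι ι R)
    (j : Option (ι × ι)) : (pencilPoint r j).map φ = pencilPoint (r.map φ) j := by
  cases j <;> simp

/-- The polynomial `f(t, r)` in `t`. -/
def pencil {B E : Type*} [CommRing B] [CommRing E] [Algebra B E] (r : Matrix ι ι E) :
    MvPolynomial (Option (ι × ι)) B →ₐ[B] Polynomial E :=
  aeval (pencilPoint r)

@[simp]
theorem pencil_X_none {B E : Type*} [CommRing B] [CommRing E] [Algebra B E] (r : Matrix ι ι E) :
    pencil r (X none : MvPolynomial (Option (ι × ι)) B) = Polynomial.X := by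
  simp [pencil]

@[simp]
theorem pencil_X_some {B E : Type*} [CommRing B] [CommRing E] [Algebra B E] (r : Matrix ι ι E)
    (p : ι × ι) :
    pencil r (X (some p) : MvPolynomial (Option (ι × ι)) B) = Polynomial.C (r p.1 p.2) := by
  simp [pencil]

@[simp]
theorem pencil_C {B E : Type*} [CommRing B] [CommRing E] [Algebra B E] (r : Matrix ι ι E)
    (b : B) :
    pencil r (C b : MvPolynomial (Option (ι × ι)) B) = Polynomial.C (algebraMap B E b) := by
  simp [pencil, Polynomial.algebraMap_apply]

theorem map_pencil {B E E' : Type*} [CommRing B] [CommRing E] [CommRing E'] [Algebra B E]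
    [Algebra B E'] (φ : E →ₐ[B] E') (r : Matrix ι ι E) (f : MvPolynomial (Option (ι × ι)) B) :
    (pencil r f).map (φ : E →+* E') = pencil (r.map φ) f := by
  have h := comp_aeval (R := B) (pencilPoint r) (Polynomial.mapAlgHom φ)
  have h1 := congrArg (fun ψ => ψ f) h
  refine h1.trans ?_
  rw [pencil]
  congr 2
  funext j
  exact map_pencilPoint _ _ _

theorem natDegree_pencil_le {B E : Type*} [CommRing B] [CommRing E] [Algebra B E]
    (r : Matrix ι ι E) {n : ℕ} {f : MvPolynomial (Option (ι × ι)) B} (hf : f.IsHomogeneous n) :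
    (pencil r f).natDegree ≤ n := by
  rw [f.as_sum, map_sum]
  refine Polynomial.natDegree_sum_le_of_forall_le _ _ fun c hc => ?_
  have hdeg : c.degree = n := by
    rw [Finsupp.degree_eq_weight_one]
    exact hf (mem_support_iff.1 hc)
  rw [monomial_eq, map_mul, pencil_C]
  refine (Polynomial.natDegree_C_mul_le _ _).trans ?_
  rw [Finsupp.prod, map_prod]
  refine (Polynomial.natDegree_prod_le _ _).trans ?_
  rw [← hdeg, Finsupp.degree]
  refine Finset.sum_le_sum fun j _ => ?_
  rw [map_pow]
  refine Polynomial.natDegree_pow_le.trans ?_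
  have : (pencil r (X j : MvPolynomial (Option (ι × ι)) B)).natDegree ≤ 1 := by
    cases j with
    | none =>
      rw [pencil_X_none]
      exact Polynomial.natDegree_X_le
    | some p => simp
  nlinarith

theorem eval_pencil {B E : Type*} [CommRing B] [CommRing E] [Algebra B E] (r : Matrix ι ι E)
    (t : E) (f : MvPolynomial (Option (ι × ι)) B) :
    (pencil r f).eval t = aeval (fun j : Option (ι × ι) => j.elim t fun p => r p.1 p.2) f := by
  have h := comp_aeval (R := B) (pencilPoint r) (Polynomial.aeval (R := E) t |>.restrictScalars B)
  have h1 := congrArg (fun φ => φ f) h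
  simp only [AlgHom.comp_apply, AlgHom.restrictScalars_apply, Polynomial.coe_aeval_eq_eval] at h1
  rw [pencil, h1]
  congr 2
  funext j
  cases j <;> simp

/-- The directions of the columns on which endomorphisms of the space of matrices are tested. -/
def direction [DecidableEq ι] (R : Type*) [CommRing R] (s : Option ι) : ι → R :=
  s.elim (fun _ => 1) fun j => Pi.single j 1

theorem map_direction [DecidableEq ι] {R S : Type*} [CommRing R] [CommRing S] (φ : R →+* S)
    (s : Option ι)
    (j : ι) : φ (direction R s j) = direction S s j := by
  cases s with
  | none => simp [direction]
  | some i => simp [direction, Pi.single_apply, apply_ite φ]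

/-- The exponent reserved for a direction. -/
def slot [Fintype ι] (low : ℕ) (s : Option ι) : ℕ := low + 1 + Fintype.equivFin (Option ι) s

/-- The least exponent of the range reserved for the equations of the group. -/
def windowStart (ι : Type) [Fintype ι] (low : ℕ) : ℕ := low + Fintype.card (Option ι) + 1

/-- The degree of the polynomials that are tested. -/
def testDegree (ι : Type) [Fintype ι] (low d : ℕ) : ℕ := windowStart ι low + d + 2

theorem slot_injective [Fintype ι] (low : ℕ) :
    Function.Injective (slot (ι := ι) low) := fun s t h => by
  apply (Fintype.equivFin (Option ι)).injective
  apply Fin.ext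
  simpa [slot] using h

theorem slot_lt [Fintype ι] (low : ℕ) (s : Option ι) : slot low s < windowStart ι low := by
  have := (Fintype.equivFin (Option ι) s).2
  simp only [slot, windowStart]
  omega

theorem lt_slot [Fintype ι] (low : ℕ) (s : Option ι) : low < slot low s := by
  simp only [slot]
  omega

variable {F : Type u} [Field F] {O : Type u} [CommRing O] [Algebra F O]

variable (F) in
/-- The test given by a linear pencil and a set of exponents. -/
def pencilTest {R : Type u} [CommRing R] [Algebra F R] (r : Matrix ι ι R) (s : Finset ℕ) :
    Test F (Option (ι × ι)) where
  R := R
  pt := pencilPoint r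
  exps := s

theorem pencilTest_value {R : Type u} [CommRing R] [Algebra F R] (r : Matrix ι ι R) (s : Finset ℕ)
    {B E : Type u} [CommRing B] [CommRing E] [Algebra F E] [Algebra B E] (y : R →ₐ[F] E)
    (f : MvPolynomial (Option (ι × ι)) B) :
    (pencilTest F r s).value y f = ∑ e ∈ s, (pencil (r.map y) f).coeff e := by
  have h : (fun j => (pencilPoint r j).map (y : R →+* E)) = pencilPoint (r.map y) :=
    funext fun j => map_pencilPoint _ _ _
  change ∑ e ∈ s, (aeval (fun j => (pencilPoint r j).map (y : R →+* E)) f).coeff e = _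
  rw [h]
  rfl

variable (F ι) in
/-- The vanishing of one coefficient at the generic matrix. -/
def genericTest (e : ℕ) : Test F (Option (ι × ι)) :=
  pencilTest F (R := MvPolynomial (ι × ι) F) (Matrix.of fun i j => X (i, j)) {e}

variable [Fintype ι] [DecidableEq ι]

variable (F) in
/-- The vanishing of one coefficient at the generic matrix of rank one with given direction. -/
def slotTest (low : ℕ) (s : Option ι) : Test F (Option (ι × ι)) :=
  pencilTest F (R := MvPolynomial ι F) (Matrix.vecMulVec X (direction _ s)) {slot low s}

variable (F) in
/-- The vanishing at the points of the group, for the part of a polynomial with exponents in the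
reserved range. -/
def groupTest (z : Matrix ι ι O) (low d : ℕ) : Test F (Option (ι × ι)) :=
  pencilTest F z (Finset.Icc (windowStart ι low) (windowStart ι low + d))

variable (F) in
/-- The tests that cut out the group of points of `O`. -/
def matrixTests (z : Matrix ι ι O) (low d : ℕ) : Set (Test F (Option (ι × ι))) :=
  {genericTest ι F low, genericTest ι F (windowStart ι low + d + 1), groupTest F z low d} ∪
    Set.range (slotTest F low)

variable {B : Type u} [CommRing B] [Algebra F B]

/-- Matrices, vectors and points of the group over `E` are the specializations of the generic
matrix, the generic vector and the matrix `z`. -/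
theorem passes_matrixTests_iff {z : Matrix ι ι O} {low d : ℕ}
    {f : MvPolynomial (Option (ι × ι)) B} :
    Passes (matrixTests F z low d) f ↔
      ∀ (E : Type u) [CommRing E] [Algebra F E] [Algebra B E] [IsScalarTower F B E],
        (∀ r : Matrix ι ι E, (pencil r f).coeff low = 0) ∧
        (∀ r : Matrix ι ι E, (pencil r f).coeff (windowStart ι low + d + 1) = 0) ∧
        (∀ (s : Option ι) (v : ι → E),
          (pencil (Matrix.vecMulVec v (direction E s)) f).coeff (slot low s) = 0) ∧
        ∀ x : O →ₐ[F] E, ∑ e ∈ Finset.Icc (windowStart ι low) (windowStart ι low + d),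
          (pencil (z.map x) f).coeff e = 0 := by
  have hgen {E : Type u} [CommRing E] [Algebra F E] (r : Matrix ι ι E) :
      r = (Matrix.of fun i j => (X (i, j) : MvPolynomial (ι × ι) F)).map
        (aeval (R := F) fun p : ι × ι => r p.1 p.2) := by
    ext i j
    simp
  have hslot (s : Option ι) {E : Type u} [CommRing E] [Algebra F E] (y : MvPolynomial ι F →ₐ[F] E) :
      (Matrix.vecMulVec X (direction (MvPolynomial ι F) s)).map y =
        Matrix.vecMulVec (fun i => y (X i)) (direction E s) := by
    ext i j
    rw [Matrix.map_apply, Matrix.vecMulVec_apply, Matrix.vecMulVec_apply, map_mul]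
    exact congrArg _ (map_direction (y : MvPolynomial ι F →+* E) s j)
  constructor
  · intro h E _ _ _ _
    refine ⟨fun r => ?_, fun r => ?_, fun s v => ?_, fun x => ?_⟩
    · rw [hgen r]
      exact (Finset.sum_singleton _ _).symm.trans ((pencilTest_value _ _ _ f).symm.trans
        (h (genericTest ι F low) (by simp [matrixTests]) E (aeval fun p => r p.1 p.2)))
    · rw [hgen r]
      exact (Finset.sum_singleton _ _).symm.trans ((pencilTest_value _ _ _ f).symm.trans
        (h (genericTest ι F (windowStart ι low + d + 1)) (by simp [matrixTests]) E
          (aeval fun p => r p.1 p.2)))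
    · have h1 := hslot s (aeval (R := F) v)
      simp only [aeval_X] at h1
      rw [← h1]
      exact (Finset.sum_singleton _ _).symm.trans ((pencilTest_value _ _ _ f).symm.trans
        (h (slotTest F low s) (by simp [matrixTests]) E (aeval v)))
    · exact (pencilTest_value _ _ _ f).symm.trans
        (h (groupTest F z low d) (by simp [matrixTests]) E x)
  · intro h T hT E _ _ _ _ y
    obtain ⟨h1, h2, h3, h4⟩ := h E
    obtain (rfl | rfl | rfl) | ⟨s, rfl⟩ := hT
    · exact (pencilTest_value _ _ y f).trans ((Finset.sum_singleton _ _).trans (h1 _))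
    · exact (pencilTest_value _ _ y f).trans ((Finset.sum_singleton _ _).trans (h2 _))
    · exact (pencilTest_value _ _ y f).trans (h4 _)
    · refine (pencilTest_value _ _ y f).trans ((Finset.sum_singleton _ _).trans ?_)
      exact (congrArg (fun r => (pencil r f).coeff (slot low s)) (hslot s y)).trans (h3 _ _)

end MatrixTests

/-! ### Left multiplications preserve the conditions; the distinguished line is preserved -/

section Recognition

open MvPolynomial

variable {ι : Type}

/-- The matrix of the action `(t, Z) ↦ (t, H Z)`. -/
def leftMulMatrix [DecidableEq ι] {B : Type*} [CommRing B] (H : Matrix ι ι B) :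
    Matrix (Option (ι × ι)) (Option (ι × ι)) B :=
  Matrix.of fun j j' => j.elim (j'.elim 1 fun _ => 0) fun p => j'.elim 0 fun p' =>
    if p.2 = p'.2 then H p.1 p'.1 else 0

theorem pencil_linSubst [Fintype ι] {B E : Type*} [CommRing B] [CommRing E] [Algebra B E]
    (γ : Matrix (Option (ι × ι)) (Option (ι × ι)) B) (r : Matrix ι ι E)
    (f : MvPolynomial (Option (ι × ι)) B) :
    pencil r (linSubst γ f) = aeval (fun j =>
      Polynomial.C (algebraMap B E (γ j none)) * Polynomial.X +
        Polynomial.C (∑ p, algebraMap B E (γ j (some p)) * r p.1 p.2)) f := by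
  rw [pencil, aeval_linSubst]
  congr 2
  funext j
  rw [Fintype.sum_option]
  simp [Polynomial.algebraMap_apply, map_sum]

section Apply

variable [DecidableEq ι] {B : Type*} [CommRing B] (H : Matrix ι ι B)

@[simp] theorem leftMulMatrix_none_none : leftMulMatrix H none none = 1 := rfl
@[simp] theorem leftMulMatrix_none_some (p : ι × ι) : leftMulMatrix H none (some p) = 0 := rfl
@[simp] theorem leftMulMatrix_some_none (p : ι × ι) : leftMulMatrix H (some p) none = 0 := rfl
theorem leftMulMatrix_some_some (p p' : ι × ι) :
    leftMulMatrix H (some p) (some p') = if p.2 = p'.2 then H p.1 p'.1 else 0 := rfl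

theorem pencil_linSubst_leftMulMatrix [Fintype ι] {E : Type*} [CommRing E] [Algebra B E]
    (r : Matrix ι ι E) (f : MvPolynomial (Option (ι × ι)) B) :
    pencil r (linSubst (leftMulMatrix H) f) = pencil (H.map (algebraMap B E) * r) f := by
  rw [pencil_linSubst, pencil]
  congr 2
  funext j
  cases j with
  | none => simp
  | some p =>
    simp [leftMulMatrix_some_some, Matrix.mul_apply, Fintype.sum_prod_type, apply_ite, ite_mul]

end Apply

variable [Fintype ι] [DecidableEq ι]

variable {F : Type u} [Field F] {O : Type u} [CommRing O] [Algebra F O]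
variable {B : Type u} [CommRing B] [Algebra F B] {z : Matrix ι ι O} {low d : ℕ}

/-- Multiplication by a point of the group preserves the tests. -/
theorem Passes.linSubst_leftMulMatrix
    (hmul : ∀ (E : Type u) [CommRing E] [Algebra F E] (x y : O →ₐ[F] E),
      ∃ w : O →ₐ[F] E, z.map w = z.map x * z.map y)
    (x : O →ₐ[F] B) {f : MvPolynomial (Option (ι × ι)) B} (h : Passes (matrixTests F z low d) f) :
    Passes (matrixTests F z low d) (linSubst (leftMulMatrix (z.map x)) f) := by
  rw [passes_matrixTests_iff] at h ⊢
  intro E _ _ _ _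
  obtain ⟨h1, h2, h3, h4⟩ := h E
  simp only [pencil_linSubst_leftMulMatrix]
  refine ⟨fun r => h1 _, fun r => h2 _, fun s v => ?_, fun y => ?_⟩
  · rw [Matrix.mul_vecMulVec]
    exact h3 _ _
  · obtain ⟨w, hw⟩ := hmul E ((IsScalarTower.toAlgHom F B E).comp x) y
    have : (z.map x).map (algebraMap B E) * z.map y = z.map w := by
      rw [hw]
      rfl
    rw [this]
    exact h4 w

/-- A polynomial with small degree in the distinguished variable passes. -/
theorem passes_of_coeff_eq_zero {f : MvPolynomial (Option (ι × ι)) B}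
    (h : ∀ (E : Type u) [CommRing E] [Algebra B E] (r : Matrix ι ι E) (e : ℕ), low ≤ e →
      e < testDegree ι low d → (pencil r f).coeff e = 0) :
    Passes (matrixTests F z low d) f := by
  rw [passes_matrixTests_iff]
  intro E _ _ _ _
  have hw : low < windowStart ι low := by
    simp only [windowStart]
    omega
  have hn : windowStart ι low + d + 1 < testDegree ι low d := Nat.lt_succ_self _
  refine ⟨fun r => h E r _ le_rfl (by omega), fun r => h E r _ (by omega) hn, fun s v => ?_,
    fun x => Finset.sum_eq_zero fun e he => ?_⟩
  · have h1 := slot_lt low s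
    exact h E _ _ (lt_slot low s).le (by omega)
  · have h3 := Finset.mem_Icc.1 he
    exact h E _ _ (by omega) (by omega)

theorem linSubst_linSubst {B J : Type*} [CommRing B] [Fintype J] (γ γ' : Matrix J J B)
    (f : MvPolynomial J B) : linSubst γ (linSubst γ' f) = linSubst (γ' * γ) f := by
  refine (aeval_linSubst γ' (fun j => ∑ j', C (γ j j') * X j') f).trans ?_
  refine congrArg (fun φ => aeval φ f) (funext fun j => ?_)
  simp only [algebraMap_eq, Finset.mul_sum, Matrix.mul_apply, map_sum, map_mul, Finset.sum_mul]
  rw [Finset.sum_comm]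
  simp only [mul_assoc]

theorem linSubst_one {B J : Type*} [CommRing B] [Fintype J] [DecidableEq J]
    (f : MvPolynomial J B) : linSubst (1 : Matrix J J B) f = f := by
  have : linSubst (1 : Matrix J J B) = AlgHom.id B _ := by
    rw [linSubst]
    ext j
    simp [Matrix.one_apply]
  rw [this, AlgHom.id_apply]

variable {γ γ' : Matrix (Option (ι × ι)) (Option (ι × ι)) B}

theorem eq_zero_of_mul_X_pow_eq_zero {B σ : Type*} [CommRing B] {i : σ} {e : ℕ}
    {f : MvPolynomial σ B} (h : f * X i ^ e = 0) : f = 0 := by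
  induction e with
  | zero => simpa using h
  | succ e ih =>
    rw [pow_succ, ← mul_assoc] at h
    exact ih (X_mul_cancel_right_iff.1 (h.trans (zero_mul (X i)).symm))

/-- A cofactor inserted in the form `f ∘ γ'` comes back as `f` after substituting `γ`. So cofactors
can be prescribed after the substitution, and only the other factor is transformed. -/
theorem linSubst_pow_mul_linSubst_eq (hγ : γ' * γ = 1) (p₁ p₂ : ι × ι) (k : ℕ)
    (f : MvPolynomial (Option (ι × ι)) B) :
    linSubst γ (X (some p₁) ^ k * X (some p₂) * linSubst γ' f) =
      linSubst γ (X (some p₁) ^ k * X (some p₂)) * f := by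
  rw [map_mul, linSubst_linSubst, hγ, linSubst_one]

/-- With `q = x_{p₁}^k x_{p₂}`, every multiple of `q` of degree `n = low + k` has degree below `low`
in `t`, hence passes. Therefore no multiple of `q ∘ γ` of degree `n` has a term in `t^low`. With
suitable cofactors, this excludes every positive power of `t` from `q ∘ γ`; comparing its values at
two points that differ only in `t` then gives the claim. -/
theorem apply_some_none_eq_zero (hlow : Fintype.card (Option ι) + d + 4 ≤ low)
    (hγ : γ' * γ = 1) (hγ' : γ * γ' = 1)
    (h : ∀ f : MvPolynomial (Option (ι × ι)) B, f.IsHomogeneous (testDegree ι low d) →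
      Passes (matrixTests F z low d) f → Passes (matrixTests F z low d) (linSubst γ f))
    {p₁ p₂ : ι × ι} (hp : p₁ ≠ p₂) : γ (some p₂) none = 0 := by
  -- This is `testDegree ι low d - low`.
  set k := Fintype.card (Option ι) + d + 3 with hk
  let q : MvPolynomial (Option (ι × ι)) B := X (some p₁) ^ k * X (some p₂)
  have hq : q.IsHomogeneous (k + 1) := by
    simpa using ((isHomogeneous_X B (some p₁)).pow k).mul (isHomogeneous_X B (some p₂))
  have hcoeff (e : ℕ) (he : e + 1 ≤ low) (E : Type u) [CommRing E] [Algebra F E] [Algebra B E]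
      [IsScalarTower F B E] (r : Matrix ι ι E) :
      (pencil r (linSubst γ q)).coeff (e + 1) * r p₁.1 p₁.2 ^ e = 0 := by
    obtain ⟨l, hl⟩ := Nat.exists_eq_add_of_le he
    -- Here `l + e = low - 1`, and the factor `t^l` moves the coefficient of `t^(e + 1)` in `q ∘ γ`
    -- to the exponent `low`.
    let f : MvPolynomial (Option (ι × ι)) B := X none ^ l * X (some p₁) ^ e
    have hf : f.IsHomogeneous (l + e) := by
      simpa using ((isHomogeneous_X B (none : Option (ι × ι))).pow l).mul
        ((isHomogeneous_X B (some p₁)).pow e)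
    have hhom : (q * linSubst γ' f).IsHomogeneous (testDegree ι low d) := by
      convert hq.mul (linSubst_isHomogeneous γ' hf) using 1
      simp only [testDegree, windowStart]
      omega
    have hpass : Passes (matrixTests F z low d) (q * linSubst γ' f) := by
      refine passes_of_coeff_eq_zero fun E _ _ r m hm _ => ?_
      have h1 : pencil r q = Polynomial.C (r p₁.1 p₁.2 ^ k * r p₂.1 p₂.2) := by
        simp [q]
      rw [map_mul, h1, Polynomial.coeff_C_mul, Polynomial.coeff_eq_zero_of_natDegree_lt, mul_zero]
      have := natDegree_pencil_le r (linSubst_isHomogeneous γ' hf)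
      omega
    have h2 := h _ hhom hpass
    rw [passes_matrixTests_iff] at h2
    have h3 := (h2 E).1 r
    rw [linSubst_pow_mul_linSubst_eq hγ, map_mul] at h3
    have hf' : pencil r f = Polynomial.X ^ l * Polynomial.C (r p₁.1 p₁.2) ^ e := by
      simp [f]
    rw [hf', ← Polynomial.C_pow, ← mul_assoc, Polynomial.coeff_mul_C, hl,
      Polynomial.coeff_mul_X_pow] at h3
    exact h3
  let E := MvPolynomial (ι × ι) B
  let r : Matrix ι ι E := Matrix.of fun i j => X (i, j)
  have hconst : pencil r (linSubst γ q) = Polynomial.C ((pencil r (linSubst γ q)).coeff 0) := by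
    refine Polynomial.eq_C_of_natDegree_le_zero ?_
    rw [Polynomial.natDegree_le_iff_coeff_eq_zero]
    intro m hm
    obtain ⟨e, rfl⟩ := Nat.exists_eq_succ_of_ne_zero hm.ne'
    by_cases he : e + 1 ≤ low
    · have h1 := hcoeff e he E r
      have hr : r p₁.1 p₁.2 = X p₁ := rfl
      rw [hr] at h1
      exact eq_zero_of_mul_X_pow_eq_zero h1
    -- The degree `k + 1` of `q ∘ γ` is at most `low`, so no exponents remain beyond those already
    -- treated.
    · refine Polynomial.coeff_eq_zero_of_natDegree_lt
        ((natDegree_pencil_le r (linSubst_isHomogeneous γ hq)).trans_lt ?_)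
      omega
  have hindep (w : ι × ι → B) (t t' : B) :
      aeval (fun j : Option (ι × ι) => j.elim t w) (linSubst γ q) =
        aeval (fun j : Option (ι × ι) => j.elim t' w) (linSubst γ q) := by
    have h1 (t : B) : aeval (fun j : Option (ι × ι) => j.elim t w) (linSubst γ q) =
        aeval w ((pencil r (linSubst γ q)).coeff 0) := by
      have h2 := congrArg (fun P => (Polynomial.map (aeval (R := B) w : E →+* B) P).eval t) hconst
      simp only [map_pencil, eval_pencil, Polynomial.map_C, Polynomial.eval_C] at h2
      refine Eq.trans ?_ h2
      congr 2
      funext j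
      cases j with
      | none => rfl
      | some p => exact (aeval_X w p).symm
    rw [h1, h1]
  -- At `w = γ⁻¹ u` the coordinate `p₂` of the image is zero, so `q ∘ γ` vanishes. Raising `t` by
  -- one makes coordinate `p₁` of the image equal to `1` and coordinate `p₂` equal to the wanted
  -- entry, which is then the value of `q ∘ γ`.
  let u : Option (ι × ι) → B := Pi.single (some p₁) (1 - γ (some p₁) none)
  let w := γ'.mulVec u
  have hw : γ.mulVec w = u := by
    rw [Matrix.mulVec_mulVec, hγ', Matrix.one_mulVec]
  have hval (v : Option (ι × ι) → B) : aeval v (linSubst γ q) =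
      (γ.mulVec v (some p₁)) ^ k * γ.mulVec v (some p₂) := by
    rw [aeval_linSubst]
    simp [q, Matrix.mulVec, dotProduct]
  have key := hindep (fun p => w (some p)) (w none + 1) (w none)
  have e1 : (fun j : Option (ι × ι) => j.elim (w none) fun p => w (some p)) = w := by
    funext j
    cases j <;> rfl
  have e2 : (fun j : Option (ι × ι) => j.elim (w none + 1) fun p => w (some p)) =
      w + Pi.single none 1 := by
    funext j
    cases j <;> simp
  rw [e1, e2, hval, hval, Matrix.mulVec_add, hw, Matrix.mulVec_single_one] at key
  have hu : u (some p₂) = 0 := by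
    simp [u, hp.symm]
  have hu1 : u (some p₁) = 1 - γ (some p₁) none := by
    simp [u]
  simpa [hu, hu1] using key

end Recognition

/-! ### Block form, left multiplications and the equations of the group -/

section Recognition

open MvPolynomial

theorem coeff_C_mul_X_add_C_pow {B : Type*} [CommRing B] {α α' : B} (hα : α * α' = 1) (b : B)
    (m : ℕ) : ((Polynomial.C α * Polynomial.X + Polynomial.C b) ^ (m + 1)).coeff m =
      α ^ m * ((m + 1 : ℕ) * b) := by
  have h : Polynomial.C α * Polynomial.X + Polynomial.C b =
      Polynomial.C α * (Polynomial.X + Polynomial.C (α' * b)) := by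
    rw [mul_add, ← Polynomial.C_mul, ← mul_assoc, hα, one_mul]
  rw [h, mul_pow, ← Polynomial.C_pow, Polynomial.coeff_C_mul, Polynomial.coeff_X_add_C_pow,
    Nat.add_sub_cancel_left, pow_one, Nat.choose_succ_self_right, pow_succ]
  linear_combination (α ^ m * b * ((m + 1 : ℕ) : B)) * hα

theorem linSubst_smul {J B : Type*} [Fintype J] [CommRing B] {n : ℕ} (α : B) (γ : Matrix J J B)
    {f : MvPolynomial J B} (hf : f.IsHomogeneous n) :
    linSubst (α • γ) f = C (α ^ n) * linSubst γ f := by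
  obtain ⟨a, rfl⟩ := exists_tensorPoly_eq hf
  rw [linSubst_tensorPoly, linSubst_tensorPoly, ← tensorPoly_smul]
  congr 1
  funext c'
  simp only [Pi.smul_apply, smul_eq_mul, Finset.mul_sum, Matrix.smul_apply, Finset.prod_mul_distrib,
    Finset.prod_const, Finset.card_univ, Fintype.card_fin]
  exact Finset.sum_congr rfl fun c _ => by ring

variable {ι : Type}

theorem pencil_rename_some {B E : Type*} [CommRing B] [CommRing E] [Algebra B E]
    (r : Matrix ι ι E) (g : MvPolynomial (ι × ι) B) :
    pencil r (rename some g) = Polynomial.C (aeval (fun p => r p.1 p.2) g) := by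
  rw [pencil, aeval_rename]
  have h := comp_aeval (R := B) (fun p : ι × ι => r p.1 p.2) (Polynomial.CAlgHom (R := B) (A := E))
  exact (congrArg (fun φ => φ g) h).symm

variable [Fintype ι] {F : Type u} [Field F] {B : Type u} [CommRing B] [Algebra F B] {low d : ℕ}

/-- The homogenization of an equation of the group, multiplied by the square of a coordinate. -/
def homogenizedEquation (B : Type u) [CommRing B] [Algebra F B] (low d : ℕ)
    (g : MvPolynomial (ι × ι) F) (p : ι × ι) : MvPolynomial (Option (ι × ι)) B :=
  ∑ β ∈ g.support, X none ^ (windowStart ι low + d - β.degree) *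
    rename some (monomial β (algebraMap F B (coeff β g))) * X (some p) ^ 2

/-- Homogenization with `t` fills each monomial up to the top exponent of the window, which is `n -
2`, and the square supplies the remaining two degrees. A gap of two is needed because the exponent
`n - 1` belongs to another condition. -/
theorem homogenizedEquation_isHomogeneous {g : MvPolynomial (ι × ι) F} (hg : g.totalDegree ≤ d)
    (p : ι × ι) : (homogenizedEquation B low d g p).IsHomogeneous (testDegree ι low d) := by
  refine IsHomogeneous.sum _ _ _ fun β hβ => ?_
  have h1 : β.degree ≤ d := (le_totalDegree hβ).trans hg
  convert (((isHomogeneous_X B (none : Option (ι × ι))).pow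
    (windowStart ι low + d - β.degree)).mul (IsHomogeneous.rename_isHomogeneous
      (isHomogeneous_monomial (algebraMap F B (coeff β g)) (n := β.degree) rfl))).mul
      ((isHomogeneous_X B (some p)).pow 2) using 1
  simp only [testDegree]
  omega

theorem coeff_pencil_homogenizedEquation {E : Type*} [CommRing E] [Algebra B E]
    (r : Matrix ι ι E) {g : MvPolynomial (ι × ι) F} (p : ι × ι) (e : ℕ) :
    (pencil r (homogenizedEquation B low d g p)).coeff e =
      ∑ β ∈ g.support, if e = windowStart ι low + d - β.degree then
        aeval (fun p => r p.1 p.2) (monomial β (algebraMap F B (coeff β g))) * r p.1 p.2 ^ 2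
      else 0 := by
  rw [homogenizedEquation, map_sum, Polynomial.finsetSum_coeff]
  refine Finset.sum_congr rfl fun β _ => ?_
  rw [map_mul, map_mul, map_pow, map_pow, pencil_X_none, pencil_X_some, pencil_rename_some,
    ← Polynomial.C_pow, mul_assoc, ← Polynomial.C_mul, mul_comm, Polynomial.coeff_C_mul,
    Polynomial.coeff_X_pow]
  split_ifs <;> simp

/-- Adding the coefficients over the window amounts to setting `t = 1`: it undoes the
homogenization. -/
theorem sum_coeff_pencil_homogenizedEquation {E : Type*} [CommRing E] [Algebra F E] [Algebra B E]
    [IsScalarTower F B E] (r : Matrix ι ι E) {g : MvPolynomial (ι × ι) F}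
    (hg : g.totalDegree ≤ d) (p : ι × ι) :
    ∑ e ∈ Finset.Icc (windowStart ι low) (windowStart ι low + d),
      (pencil r (homogenizedEquation B low d g p)).coeff e =
        aeval (fun p => r p.1 p.2) g * r p.1 p.2 ^ 2 := by
  simp only [coeff_pencil_homogenizedEquation]
  rw [Finset.sum_comm]
  conv_rhs => rw [g.as_sum, map_sum, Finset.sum_mul]
  refine Finset.sum_congr rfl fun β hβ => ?_
  have h1 : β.degree ≤ d := (le_totalDegree hβ).trans hg
  rw [Finset.sum_ite_eq', if_pos (Finset.mem_Icc.2 ⟨by omega, by omega⟩), aeval_monomial,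
    aeval_monomial, ← IsScalarTower.algebraMap_apply]

variable [DecidableEq ι] {O : Type u} [CommRing O] [Algebra F O] {z : Matrix ι ι O}
variable {γ γ' : Matrix (Option (ι × ι)) (Option (ι × ι)) B}

theorem passes_X_none_pow :
    Passes (matrixTests F z low d) (X none ^ testDegree ι low d :
      MvPolynomial (Option (ι × ι)) B) := by
  refine passes_of_coeff_eq_zero fun E _ _ r e _ he => ?_
  rw [map_pow, pencil_X_none, Polynomial.coeff_X_pow, if_neg he.ne]

theorem passes_X_some_pow (hlow : 1 ≤ low) (p : ι × ι) (n : ℕ) :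
    Passes (matrixTests F z low d) (X (some p) ^ n : MvPolynomial (Option (ι × ι)) B) := by
  refine passes_of_coeff_eq_zero fun E _ _ r e he _ => ?_
  rw [map_pow, pencil_X_some, ← Polynomial.C_pow, Polynomial.coeff_C, if_neg (by omega)]

theorem apply_none_none_mul (hγ : γ' * γ = 1) (hcol : ∀ p, γ (some p) none = 0) :
    γ none none * γ' none none = 1 := by
  have := congrFun (congrFun hγ none) none
  rw [Matrix.mul_apply, Fintype.sum_option] at this
  simpa [hcol, mul_comm] using this

theorem inverse_apply_some_none (hγ : γ' * γ = 1) (hcol : ∀ p, γ (some p) none = 0)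
    (p : ι × ι) : γ' (some p) none = 0 := by
  have := congrFun (congrFun hγ (some p)) none
  rw [Matrix.mul_apply, Fintype.sum_option] at this
  simp only [hcol, mul_zero, Finset.sum_const_zero, add_zero, Matrix.one_apply, reduceCtorEq,
    if_false] at this
  calc γ' (some p) none = γ' (some p) none * (γ none none * γ' none none) := by
        rw [apply_none_none_mul hγ hcol, mul_one]
    _ = 0 := by rw [← mul_assoc, this, zero_mul]

/-- The power `t^n` passes, and `γ` turns it into `(αt + b)^n` with `α` a unit and `b` linear in the
matrix entries. Its coefficient at `t^(n - 1)` is `n α^(n - 1) b`, so invertibility of `n` gives `b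
= 0`. -/
theorem apply_none_some_eq_zero (hn : (testDegree ι low d : F) ≠ 0)
    (hγ : γ' * γ = 1) (hcol : ∀ p, γ (some p) none = 0)
    (h : ∀ f : MvPolynomial (Option (ι × ι)) B, f.IsHomogeneous (testDegree ι low d) →
      Passes (matrixTests F z low d) f → Passes (matrixTests F z low d) (linSubst γ f))
    (p : ι × ι) : γ none (some p) = 0 := by
  have hα := apply_none_none_mul hγ hcol
  have h1 := h (X none ^ testDegree ι low d)
    (by simpa using (isHomogeneous_X B (none : Option (ι × ι))).pow (testDegree ι low d))
    passes_X_none_pow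
  rw [passes_matrixTests_iff] at h1
  -- At this elementary matrix the form `b` takes the value of its coefficient at `p`.
  have h2 := (h1 B).2.1 (Matrix.single p.1 p.2 1)
  rw [pencil_linSubst, map_pow, aeval_X] at h2
  rw [show testDegree ι low d = (windowStart ι low + d + 1) + 1 from rfl] at h2 hn
  rw [coeff_C_mul_X_add_C_pow (α' := γ' none none) (by simpa using hα)] at h2
  have hsum : ∑ p', algebraMap B B (γ none (some p')) * Matrix.single p.1 p.2 (1 : B) p'.1 p'.2 =
      γ none (some p) := by
    rw [Finset.sum_eq_single p]
    · simp
    · intro p' _ hp'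
      rw [Matrix.single_apply, if_neg, mul_zero]
      rintro ⟨h1, h2⟩
      exact hp' (Prod.ext h1.symm h2.symm)
    · simp
  rw [hsum] at h2
  have hu : IsUnit (algebraMap B B (γ none none) ^ (windowStart ι low + d + 1)) :=
    (IsUnit.of_mul_eq_one _ hα).pow _
  have hu' : IsUnit ((windowStart ι low + d + 1 + 1 : ℕ) : B) := by
    have := (IsUnit.mk0 _ hn).map (algebraMap F B)
    rwa [map_natCast] at this
  exact hu'.mul_right_eq_zero.1 (hu.mul_right_eq_zero.1 h2)

theorem passes_of_slot (s : Option ι) {f : MvPolynomial (Option (ι × ι)) B}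
    (h : ∀ (E : Type u) [CommRing E] [Algebra B E] (r : Matrix ι ι E) (e : ℕ),
      e ≠ slot low s → (pencil r f).coeff e = 0)
    (h' : ∀ (E : Type u) [CommRing E] [Algebra B E] (v : ι → E),
      (pencil (Matrix.vecMulVec v (direction E s)) f).coeff (slot low s) = 0) :
    Passes (matrixTests F z low d) f := by
  rw [passes_matrixTests_iff]
  intro E _ _ _ _
  have h1 := slot_lt low s
  refine ⟨fun r => h E r _ (lt_slot low s).ne, fun r => h E r _ (by omega), fun s' v => ?_,
    fun x => Finset.sum_eq_zero fun e he => ?_⟩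
  · by_cases hs : s' = s
    · subst hs
      exact h' E v
    · exact h E _ _ fun h2 => hs (slot_injective low h2)
  · have h3 := Finset.mem_Icc.1 he
    exact h E _ _ (by omega)

/-- If a linear form `ℓ` vanishes on all `v ⊗ direction s`, then `t^slot · ℓ` times any polynomial
of complementary degree in the matrix entries passes. Applying `γ` shows that `ℓ` also vanishes on
the image of `e_a ⊗ direction s`. In other words, `γ` preserves the space of matrices `v ⊗ direction
s`. -/
theorem sum_apply_direction_eq_zero (hγ : γ' * γ = 1)
    (hcol : ∀ p, γ (some p) none = 0) (hrow : ∀ p, γ none (some p) = 0)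
    (h : ∀ f : MvPolynomial (Option (ι × ι)) B, f.IsHomogeneous (testDegree ι low d) →
      Passes (matrixTests F z low d) f → Passes (matrixTests F z low d) (linSubst γ f))
    (s : Option ι) {b₀ : ι} (hb₀ : direction B s b₀ = 1) (a : ι) (l : ι × ι → B)
    (hl : ∀ i, ∑ j, l (i, j) * direction B s j = 0) :
    ∑ p, l p * ∑ b, γ (some p) (some (a, b)) * direction B s b = 0 := by
  obtain ⟨k, hk⟩ : ∃ k, testDegree ι low d = slot low s + 1 + k :=
    Nat.exists_eq_add_of_le (by
      have := slot_lt low s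
      simp only [testDegree]
      omega)
  let ℓ : MvPolynomial (Option (ι × ι)) B := ∑ p, C (l p) * X (some p)
  -- The last factor does not involve `t`, because `γ'` also preserves the distinguished line. After
  -- substitution of `γ` it becomes `x_{(a, b₀)} ^ k`, whose value at `e_a ⊗ direction s` is `1`.
  let f : MvPolynomial (Option (ι × ι)) B :=
    X none ^ slot low s * ℓ * linSubst γ' (X (some (a, b₀))) ^ k
  have hhom : f.IsHomogeneous (testDegree ι low d) := by
    have h1 : ℓ.IsHomogeneous 1 := IsHomogeneous.sum _ _ _ fun p _ => by
      simpa using (isHomogeneous_C _ (l p)).mul (isHomogeneous_X B (some p))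
    rw [hk]
    simpa using (((isHomogeneous_X B (none : Option (ι × ι))).pow (slot low s)).mul h1).mul
      ((linSubst_isHomogeneous γ' (isHomogeneous_X B (some (a, b₀)))).pow k)
  have hpencil (E : Type u) [CommRing E] [Algebra B E] (r : Matrix ι ι E) : ∃ e : E,
      pencil r f = Polynomial.X ^ slot low s *
        Polynomial.C ((∑ p, algebraMap B E (l p) * r p.1 p.2) * e) := by
    refine ⟨(∑ p, algebraMap B E (γ' (some (a, b₀)) (some p)) * r p.1 p.2) ^ k, ?_⟩
    simp only [f, ℓ, map_mul, map_pow, map_sum, pencil_X_none, pencil_X_some, pencil_C,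
      pencil_linSubst, aeval_X, inverse_apply_some_none hγ hcol, map_zero, zero_mul, zero_add,
      mul_assoc]
  have hpass : Passes (matrixTests F z low d) f := by
    refine passes_of_slot s (fun E _ _ r e he => ?_) fun E _ _ v => ?_
    · obtain ⟨c, hc⟩ := hpencil E r
      rw [hc, Polynomial.coeff_X_pow_mul']
      split_ifs with h1
      · exact Polynomial.coeff_C_of_ne_zero (by omega)
      · rfl
    · obtain ⟨c, hc⟩ := hpencil E (Matrix.vecMulVec v (direction E s))
      rw [hc, Fintype.sum_prod_type]
      have h1 (i : ι) : ∑ j, algebraMap B E (l (i, j)) *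
          Matrix.vecMulVec v (direction E s) i j = 0 := by
        have := congrArg (algebraMap B E) (hl i)
        simp only [map_sum, map_mul, map_direction, map_zero] at this
        simp only [Matrix.vecMulVec_apply, mul_left_comm _ (v i), ← Finset.mul_sum, this, mul_zero]
      simp only [h1, Finset.sum_const_zero, zero_mul, map_zero, mul_zero, Polynomial.coeff_zero]
  have h2 := h f hhom hpass
  rw [passes_matrixTests_iff] at h2
  have h3 := (h2 B).2.2.1 s (Pi.single a 1)
  have hf : linSubst γ f = linSubst γ (X none ^ slot low s * ℓ) * X (some (a, b₀)) ^ k := by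
    simp only [f, map_mul (linSubst γ), map_pow (linSubst γ), linSubst_linSubst, hγ, linSubst_one]
  rw [hf, map_mul, pencil_linSubst] at h3
  simp only [ℓ, map_mul, map_pow, map_sum, aeval_X, aeval_C, hcol, hrow, pencil_X_some, map_zero,
    zero_mul, zero_add, Finset.sum_const_zero, add_zero, Polynomial.algebraMap_apply,
    Algebra.algebraMap_self_apply, Matrix.vecMulVec_apply, Pi.single_eq_same, hb₀, mul_one,
    Polynomial.C_1, one_pow, mul_pow] at h3
  simp only [← Polynomial.C_mul, ← map_sum, ← Polynomial.C_pow] at h3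
  rw [mul_right_comm, ← Polynomial.C_mul, Polynomial.coeff_C_mul, Polynomial.coeff_X_pow,
    if_pos rfl, mul_one] at h3
  have hu : IsUnit (γ none none ^ slot low s) :=
    (IsUnit.of_mul_eq_one _ (apply_none_none_mul hγ hcol)).pow _
  rw [hu.mul_right_eq_zero] at h3
  rw [← h3]
  refine Finset.sum_congr rfl fun p _ => congrArg _ ?_
  symm
  rw [Fintype.sum_prod_type, Finset.sum_eq_single a]
  · simp
  · intro i _ hi
    simp [hi]
  · simp

/-- Preserving the matrices supported in column `j`, for each `j`, means that columns do not mix.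
Preserving the matrices with all columns equal means that the same endomorphism acts on each column.
-/
theorem eq_smul_leftMulMatrix (hγ : γ' * γ = 1)
    (hcol : ∀ p, γ (some p) none = 0) (hrow : ∀ p, γ none (some p) = 0)
    (h : ∀ f : MvPolynomial (Option (ι × ι)) B, f.IsHomogeneous (testDegree ι low d) →
      Passes (matrixTests F z low d) f → Passes (matrixTests F z low d) (linSubst γ f)) :
    ∃ H : Matrix ι ι B, γ = γ none none • leftMulMatrix H := by
  have hα := apply_none_none_mul hγ hcol
  -- The entry in column `k` is a linear form vanishing on `v ⊗ e_j`.
  have hsome (i k j b : ι) (hkj : k ≠ j) : γ (some (i, k)) (some (b, j)) = 0 := by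
    have := sum_apply_direction_eq_zero hγ hcol hrow h (some j) (b₀ := j) (by simp [direction]) b
      (Pi.single (i, k) 1) fun i' => by
        simp [direction, Pi.single_apply, Prod.ext_iff, hkj.symm]
    simpa [direction, Pi.single_apply] using this
  -- The difference of two entries in the same row is a linear form vanishing on `v ⊗ (1, …, 1)`.
  have hnone (i k j b : ι) : γ (some (i, k)) (some (b, k)) = γ (some (i, j)) (some (b, j)) := by
    have := sum_apply_direction_eq_zero hγ hcol hrow h none (b₀ := b) (by simp [direction]) b
      (Pi.single (i, k) 1 - Pi.single (i, j) 1) fun i' => by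
        simp only [direction, Option.elim_none, mul_one, Pi.sub_apply, Finset.sum_sub_distrib,
          Pi.single_apply, Prod.ext_iff]
        by_cases hi : i' = i <;> simp [hi]
    have hsum (k : ι) : ∑ b', γ (some (i, k)) (some (b, b')) = γ (some (i, k)) (some (b, k)) :=
      Finset.sum_eq_single k (fun b' _ hb => hsome _ _ _ _ hb.symm) (by simp)
    simp only [direction, Option.elim_none, mul_one, Pi.sub_apply, sub_mul, hsum,
      Finset.sum_sub_distrib, Pi.single_apply, ite_mul, one_mul, zero_mul, Finset.sum_ite_eq',
      Finset.mem_univ, if_true] at this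
    simpa [hsum] using sub_eq_zero.1 this
  -- By the previous step any column may be used; the column `i` is a choice that needs no further
  -- index. The factor `γ' none none` is the inverse of the scalar.
  refine ⟨Matrix.of fun i b => γ' none none * γ (some (i, i)) (some (b, i)), ?_⟩
  ext j j'
  rw [Matrix.smul_apply, smul_eq_mul]
  cases j with
  | none => cases j' <;> simp [hrow]
  | some p =>
    cases j' with
    | none => simp [hcol]
    | some p' =>
      rw [leftMulMatrix_some_some]
      split_ifs with hp
      · rw [Matrix.of_apply, ← mul_assoc, hα, one_mul, ← hnone p.1 p.2 p.1 p'.1]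
        conv_rhs => rw [hp]
        conv_lhs => rw [← Prod.mk.eta (p := p), hp]
      · rw [mul_zero]
        exact hsome _ _ _ _ hp

/-- All exponents of `t` lie in the window, so only the condition at the points of the group is not
automatic, and there the sum of coefficients is a multiple of `g(z) = 0`. -/
theorem passes_homogenizedEquation {g : MvPolynomial (ι × ι) F} (hg : g.totalDegree ≤ d)
    (hz : aeval (fun p => z p.1 p.2) g = 0) (p : ι × ι) :
    Passes (matrixTests F z low d) (homogenizedEquation B low d g p) := by
  rw [passes_matrixTests_iff]
  intro E _ _ _ _
  have h0 (r : Matrix ι ι E) (e : ℕ)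
      (he : e < windowStart ι low ∨ windowStart ι low + d < e) :
      (pencil r (homogenizedEquation B low d g p)).coeff e = 0 := by
    rw [coeff_pencil_homogenizedEquation]
    refine Finset.sum_eq_zero fun β hβ => if_neg ?_
    have h1 : β.degree ≤ d := (le_totalDegree hβ).trans hg
    omega
  refine ⟨fun r => h0 _ _ (Or.inl ?_), fun r => h0 _ _ (Or.inr (by omega)),
    fun s v => h0 _ _ (Or.inl (slot_lt low s)), fun x => ?_⟩
  · simp only [windowStart]
    omega
  · rw [sum_coeff_pencil_homogenizedEquation _ hg]
    have := congrArg x hz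
    rw [map_zero, ← AlgHom.comp_apply, comp_aeval] at this
    simp only [Matrix.map_apply]
    rw [this, zero_mul]

theorem exists_algHom_map_eq {ι F O B : Type*} [Field F] [CommRing O] [Algebra F O] [CommRing B]
    [Algebra F B] {z : Matrix ι ι O}
    (hz : Function.Surjective (aeval (R := F) fun p : ι × ι => z p.1 p.2)) (H : Matrix ι ι B)
    (hker : ∀ g : MvPolynomial (ι × ι) F, aeval (R := F) (fun p : ι × ι => z p.1 p.2) g = 0 →
      aeval (R := F) (fun p : ι × ι => H p.1 p.2) g = 0) :
    ∃ x : O →ₐ[F] B, z.map x = H := by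
  refine ⟨(Ideal.Quotient.liftₐ (RingHom.ker (aeval (R := F) fun p : ι × ι => z p.1 p.2))
    (aeval (R := F) fun p : ι × ι => H p.1 p.2) hker).comp
      (Ideal.quotientKerAlgEquivOfSurjective hz).symm.toAlgHom, ?_⟩
  ext i j
  have h1 : (Ideal.quotientKerAlgEquivOfSurjective hz).symm (z i j) =
      Ideal.Quotient.mk _ (X (i, j)) := by
    rw [AlgEquiv.symm_apply_eq]
    exact (aeval_X (fun p : ι × ι => z p.1 p.2) (i, j)).symm
  change Ideal.Quotient.liftₐ _ _ hker
    ((Ideal.quotientKerAlgEquivOfSurjective hz).symm (z i j)) = _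
  rw [h1]
  exact aeval_X (fun p : ι × ι => H p.1 p.2) (i, j)

/-- The elements of `GL(W)` whose action preserves all conditions are, up to scalars, the points
of the group. -/
theorem exists_eq_smul_leftMulMatrix [Nontrivial ι]
    (hlow : Fintype.card (Option ι) + d + 4 ≤ low) (hn : (testDegree ι low d : F) ≠ 0)
    (hone : ∃ x : O →ₐ[F] B, z.map x = 1)
    (hz : Function.Surjective (aeval (R := F) fun p : ι × ι => z p.1 p.2))
    {S : Set (MvPolynomial (ι × ι) F)}
    (hS : Ideal.span S = RingHom.ker (aeval (R := F) fun p : ι × ι => z p.1 p.2))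
    (hd : ∀ g ∈ S, g.totalDegree ≤ d)
    (hγ : γ' * γ = 1) (hγ' : γ * γ' = 1)
    (h : ∀ f : MvPolynomial (Option (ι × ι)) B, f.IsHomogeneous (testDegree ι low d) →
      Passes (matrixTests F z low d) f → Passes (matrixTests F z low d) (linSubst γ f)) :
    ∃ (α : Bˣ) (x : O →ₐ[F] B), γ = (α : B) • leftMulMatrix (z.map x) := by
  have hcol (p : ι × ι) : γ (some p) none = 0 := by
    obtain ⟨p', hp'⟩ := exists_ne p
    exact apply_some_none_eq_zero hlow hγ hγ' h hp'
  have hrow := apply_none_some_eq_zero hn hγ hcol h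
  obtain ⟨H, hH⟩ := eq_smul_leftMulMatrix hγ hcol hrow h
  have hα := apply_none_none_mul hγ hcol
  have hα' : γ' none none * γ none none = 1 := by rw [mul_comm, hα]
  have hvanish (g : MvPolynomial (ι × ι) F) (hg : g.totalDegree ≤ d)
      (hzg : aeval (fun p => z p.1 p.2) g = 0) (p : ι × ι) :
      aeval (fun p => H p.1 p.2) g * H p.1 p.2 ^ 2 = 0 := by
    obtain ⟨x, hx⟩ := hone
    have h1 := h _ (homogenizedEquation_isHomogeneous (low := low) hg p)
      (passes_homogenizedEquation hg hzg p)
    rw [passes_matrixTests_iff] at h1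
    -- The transformed equation is tested at the identity of the group, where it becomes a unit
    -- times `g(H) · H_p ^ 2`.
    have h2 := (h1 B).2.2.2 x
    rw [hH, linSubst_smul _ _ (homogenizedEquation_isHomogeneous (low := low) hg p), hx] at h2
    simp only [map_mul, pencil_C, Polynomial.coeff_C_mul, ← Finset.mul_sum] at h2
    rw [pencil_linSubst_leftMulMatrix, sum_coeff_pencil_homogenizedEquation _ hg, mul_one] at h2
    have hu : IsUnit (algebraMap B B (γ none none ^ testDegree ι low d)) :=
      (IsUnit.of_mul_eq_one _ hα).pow _
    exact hu.mul_right_eq_zero.1 h2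
  -- Since `γ` is invertible, a diagonal entry of `γ * γ' = 1` expresses `1` through the entries of
  -- `H`. The squares of the entries then generate the unit ideal too, which removes the factor `H_p
  -- ^ 2`.
  have hspan : Ideal.span (Set.range fun p : ι × ι => H p.1 p.2) = ⊤ := by
    rw [Ideal.eq_top_iff_one]
    obtain ⟨i⟩ : Nonempty ι := inferInstance
    have h1 := congrFun (congrFun hγ' (some (i, i))) (some (i, i))
    rw [Matrix.one_apply_eq, Matrix.mul_apply, Fintype.sum_option, hcol, zero_mul, zero_add] at h1
    rw [← h1]
    refine Ideal.sum_mem _ fun p _ => Ideal.mul_mem_right _ _ ?_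
    rw [hH, Matrix.smul_apply, smul_eq_mul, leftMulMatrix_some_some]
    split_ifs
    · exact Ideal.mul_mem_left _ _ (Ideal.subset_span ⟨(i, p.1), rfl⟩)
    · rw [mul_zero]
      exact Ideal.zero_mem _
  have hzero (g : MvPolynomial (ι × ι) F) (hg : g ∈ S) : aeval (fun p => H p.1 p.2) g = 0 := by
    have hgz : aeval (R := F) (fun p : ι × ι => z p.1 p.2) g = 0 := by
      rw [← RingHom.mem_ker, ← hS]
      exact Ideal.subset_span hg
    have h1 (c : B) (hc : c ∈ Ideal.span ((fun x => x ^ 2) ''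
        Set.range fun p : ι × ι => H p.1 p.2)) : c * aeval (fun p => H p.1 p.2) g = 0 := by
      induction hc using Submodule.span_induction with
      | mem c hc =>
        obtain ⟨_, ⟨p, rfl⟩, rfl⟩ := hc
        rw [mul_comm]
        exact hvanish g (hd g hg) hgz p
      | zero => rw [zero_mul]
      | add c c' _ _ h h' => rw [add_mul, h, h', add_zero]
      | smul r c _ h => rw [smul_eq_mul, mul_assoc, h, mul_zero]
    have h2 := h1 1 (by
      rw [Ideal.span_pow_eq_top _ hspan 2]
      trivial)
    rwa [one_mul] at h2
  have hker : ∀ g : MvPolynomial (ι × ι) F, aeval (R := F) (fun p : ι × ι => z p.1 p.2) g = 0 →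
      aeval (R := F) (fun p : ι × ι => H p.1 p.2) g = 0 := by
    have : RingHom.ker (aeval (R := F) fun p : ι × ι => z p.1 p.2) ≤
        RingHom.ker (aeval (R := F) fun p : ι × ι => H p.1 p.2) := by
      rw [← hS, Ideal.span_le]
      exact hzero
    exact this
  obtain ⟨x, hx⟩ := exists_algHom_map_eq hz H hker
  exact ⟨⟨γ none none, γ' none none, hα, hα'⟩, x, by rw [hx]; exact hH⟩

end Recognition

/-! ### Faithful matrix representations of affine groups of finite type -/

section Representations

/-- A functorial group structure on the points of an algebra. -/
structure PointGroup (F O : Type u) [Field F] [CommRing O] [Algebra F O] where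
  /-- The multiplication of points. -/
  mul : ∀ {A : Type u} [CommRing A] [Algebra F A], (O →ₐ[F] A) → (O →ₐ[F] A) → (O →ₐ[F] A)
  /-- The neutral point. -/
  one : ∀ (A : Type u) [CommRing A] [Algebra F A], O →ₐ[F] A
  /-- The inverse of a point. -/
  inv : ∀ {A : Type u} [CommRing A] [Algebra F A], (O →ₐ[F] A) → (O →ₐ[F] A)
  mul_assoc : ∀ {A : Type u} [CommRing A] [Algebra F A] (x y w : O →ₐ[F] A),
    mul (mul x y) w = mul x (mul y w)
  one_mul : ∀ {A : Type u} [CommRing A] [Algebra F A] (x : O →ₐ[F] A), mul (one A) x = x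
  mul_one : ∀ {A : Type u} [CommRing A] [Algebra F A] (x : O →ₐ[F] A), mul x (one A) = x
  mul_inv : ∀ {A : Type u} [CommRing A] [Algebra F A] (x : O →ₐ[F] A), mul x (inv x) = one A
  inv_mul : ∀ {A : Type u} [CommRing A] [Algebra F A] (x : O →ₐ[F] A), mul (inv x) x = one A
  comp_mul : ∀ {A A' : Type u} [CommRing A] [Algebra F A] [CommRing A'] [Algebra F A']
    (φ : A →ₐ[F] A') (x y : O →ₐ[F] A), φ.comp (mul x y) = mul (φ.comp x) (φ.comp y)
  comp_one : ∀ {A A' : Type u} [CommRing A] [Algebra F A] [CommRing A'] [Algebra F A']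
    (φ : A →ₐ[F] A'), φ.comp (one A) = one A'

namespace PointGroup

open Algebra.TensorProduct

variable {F O : Type u} [Field F] [CommRing O] [Algebra F O] (P : PointGroup F O)

/-- The comultiplication. -/
def comul : O →ₐ[F] O ⊗[F] O := P.mul includeLeft includeRight

theorem mul_eq {A : Type u} [CommRing A] [Algebra F A] (x y : O →ₐ[F] A) :
    P.mul x y = (productMap x y).comp P.comul := by
  rw [comul, comp_mul, productMap_left, productMap_right]

theorem one_apply {A : Type u} [CommRing A] [Algebra F A] (f : O) :
    P.one A f = algebraMap F A (P.one F f) := by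
  rw [← P.comp_one (Algebra.ofId F A)]
  rfl

/-- A subspace of the coordinate ring that is stable under right translations. -/
def IsStable (V : Submodule F O) : Prop :=
  ∀ v ∈ V, P.comul v ∈ LinearMap.range (LinearMap.rTensor O V.subtype)

/-- Expand the comultiplication of `f` along a basis of the second factor and take the span `V` of
the finitely many coefficients. The counit gives `f ∈ V`, and coassociativity gives stability. -/
theorem exists_stable (f : O) :
    ∃ V : Submodule F O, FiniteDimensional F V ∧ f ∈ V ∧ P.IsStable V := by
  let b := Module.Basis.ofVectorSpace F O
  let bO := Algebra.TensorProduct.basis O b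
  let c := bO.repr (P.comul f)
  have hc : P.comul f = ∑ k ∈ c.support, c k ⊗ₜ[F] b k := by
    conv_lhs => rw [← bO.linearCombination_repr (P.comul f)]
    rw [Finsupp.linearCombination_apply, Finsupp.sum]
    refine Finset.sum_congr rfl fun k _ => ?_
    rw [Algebra.TensorProduct.basis_apply, TensorProduct.smul_tmul', smul_eq_mul, _root_.mul_one]
  let V : Submodule F O := Submodule.span F (c '' c.support)
  have hcV (k) : c k ∈ V := by
    by_cases hk : k ∈ c.support
    · exact Submodule.subset_span ⟨k, hk, rfl⟩
    · rw [Finsupp.notMem_support_iff.1 hk]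
      exact V.zero_mem
  refine ⟨V, FiniteDimensional.span_of_finite F (c.support.finite_toSet.image c), ?_, ?_⟩
  · have h1 := congrArg (fun φ => φ f) (P.mul_one (AlgHom.id F O))
    simp only [mul_eq, AlgHom.comp_apply, hc, map_sum, productMap_apply_tmul, AlgHom.id_apply] at h1
    rw [← h1]
    refine V.sum_mem fun k _ => ?_
    rw [one_apply, mul_comm, ← Algebra.smul_def]
    exact V.smul_mem _ (hcV k)
  · intro v hv
    have hcoef (k₀) : P.comul (c k₀) ∈ LinearMap.range (LinearMap.rTensor O V.subtype) := by
      let j₁ : O →ₐ[F] (O ⊗[F] O) ⊗[F] O := (includeLeft : O ⊗[F] O →ₐ[F] _).comp includeLeft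
      let j₂ : O →ₐ[F] (O ⊗[F] O) ⊗[F] O := (includeLeft : O ⊗[F] O →ₐ[F] _).comp includeRight
      let j₃ : O →ₐ[F] (O ⊗[F] O) ⊗[F] O := includeRight
      -- Applying the coordinate `k₀` to the third factor of the iterated comultiplication of `f`
      -- gives the comultiplication of `c k₀` for one bracketing, and a sum of terms `c k ⊗ u` for
      -- the other.
      let θ : (O ⊗[F] O) ⊗[F] O →ₗ[F] O ⊗[F] O :=
        (TensorProduct.rid F (O ⊗[F] O)).toLinearMap ∘ₗ (b.coord k₀).lTensor (O ⊗[F] O)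
      have hθ (u : O ⊗[F] O) (w : O) : θ (u ⊗ₜ w) = b.coord k₀ w • u := by
        simp [θ]
      have h12 : P.mul j₁ j₂ = (includeLeft : O ⊗[F] O →ₐ[F] (O ⊗[F] O) ⊗[F] O).comp P.comul := by
        rw [comul, comp_mul]
      have hl : θ (P.mul (P.mul j₁ j₂) j₃ f) = P.comul (c k₀) := by
        rw [h12, mul_eq, AlgHom.comp_apply, hc, map_sum, map_sum]
        simp only [productMap_apply_tmul, AlgHom.comp_apply, includeLeft_apply, j₃,
          includeRight_apply, tmul_mul_tmul, _root_.mul_one, _root_.one_mul, hθ]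
        rw [Finset.sum_eq_single k₀]
        · simp
        · intro k _ hk
          simp [hk]
        · intro hk
          simp [Finsupp.notMem_support_iff.1 hk]
      have hr (g : O) (u : O ⊗[F] O) :
          θ (j₁ g * productMap j₂ j₃ u) ∈ Submodule.map (TensorProduct.mk F O O g) ⊤ := by
        induction u using TensorProduct.induction_on with
        | zero => simp
        | add u u' h h' =>
          rw [map_add, mul_add, map_add]
          exact Submodule.add_mem _ h h'
        | tmul p q =>
          refine ⟨b.coord k₀ q • p, trivial, ?_⟩
          simp [j₁, j₂, j₃, hθ]
      have hassoc : θ (P.mul (P.mul j₁ j₂) j₃ f) = θ (P.mul j₁ (P.mul j₂ j₃) f) := by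
        rw [P.mul_assoc]
      rw [hl] at hassoc
      rw [hassoc, mul_eq, AlgHom.comp_apply, hc, map_sum, map_sum]
      refine Submodule.sum_mem _ fun k _ => ?_
      rw [productMap_apply_tmul, mul_eq]
      obtain ⟨u, -, hu⟩ := hr (c k) (P.comul (b k))
      exact ⟨⟨c k, hcV k⟩ ⊗ₜ u, Eq.trans (by simp) hu⟩
    induction hv using Submodule.span_induction with
    | mem x hx =>
      obtain ⟨k, -, rfl⟩ := hx
      exact hcoef k
    | zero => simp
    | add x y _ _ h h' =>
      rw [map_add]
      exact Submodule.add_mem _ h h'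
    | smul r x _ h =>
      rw [map_smul]
      exact Submodule.smul_mem _ _ h

theorem IsStable.sup {V V' : Submodule F O} (h : P.IsStable V) (h' : P.IsStable V') :
    P.IsStable (V ⊔ V') := by
  have hmono {U U' : Submodule F O} (hU : U ≤ U') :
      LinearMap.range (LinearMap.rTensor O U.subtype) ≤
        LinearMap.range (LinearMap.rTensor O U'.subtype) := by
    rw [← Submodule.subtype_comp_inclusion U U' hU, LinearMap.rTensor_comp]
    exact LinearMap.range_comp_le_range _ _
  intro v hv
  obtain ⟨x, hx, y, hy, rfl⟩ := Submodule.mem_sup.1 hv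
  rw [map_add]
  exact Submodule.add_mem _ (hmono le_sup_left (h x hx)) (hmono le_sup_right (h' y hy))

theorem exists_stable_finset (s : Finset O) :
    ∃ V : Submodule F O, FiniteDimensional F V ∧ (s : Set O) ⊆ V ∧ P.IsStable V := by
  classical
  induction s using Finset.induction_on with
  | empty => exact ⟨⊥, inferInstance, by simp, fun v hv => by
      rw [Submodule.mem_bot] at hv
      simp [hv]⟩
  | insert f s _ ih =>
    obtain ⟨V, _, hV, h⟩ := ih
    obtain ⟨U, _, hU, h'⟩ := P.exists_stable f
    refine ⟨U ⊔ V, inferInstance, ?_, h'.sup P h⟩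
    rw [Finset.coe_insert, Set.insert_subset_iff]
    exact ⟨(le_sup_left : U ≤ _) hU, hV.trans (le_sup_right : V ≤ U ⊔ V)⟩

/-- A matrix representation whose entries generate the coordinate ring. -/
structure IsGeneratingMatrix {ι : Type} [Fintype ι] [DecidableEq ι] (z : Matrix ι ι O) : Prop where
  surjective : Function.Surjective (MvPolynomial.aeval (R := F) fun p : ι × ι => z p.1 p.2)
  map_mul : ∀ {A : Type u} [CommRing A] [Algebra F A] (x y : O →ₐ[F] A),
    z.map (P.mul x y) = z.map x * z.map y
  map_one : ∀ (A : Type u) [CommRing A] [Algebra F A], z.map (P.one A) = 1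

/-- The matrix describes translation on a finite-dimensional stable space containing algebra
generators. Evaluating `v_j` at the product of the identity point with the generic point gives `v_j
= ∑ v_i(1) z_ij`, so the entries generate `O`. -/
theorem exists_isGeneratingMatrix_fin [Algebra.FiniteType F O] :
    ∃ (m : ℕ) (z : Matrix (Fin m) (Fin m) O), P.IsGeneratingMatrix z := by
  obtain ⟨s, hs⟩ := (Algebra.FiniteType.out : (⊤ : Subalgebra F O).FG)
  obtain ⟨V, _, hsV, hV⟩ := P.exists_stable_finset s
  let v := Module.finBasis F V
  have htensor (t : V ⊗[F] O) : ∃ z : Fin (Module.finrank F V) → O, t = ∑ i, v i ⊗ₜ z i := by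
    induction t using TensorProduct.induction_on with
    | zero => exact ⟨0, by simp⟩
    | add t t' h h' =>
      obtain ⟨z, rfl⟩ := h
      obtain ⟨z', rfl⟩ := h'
      exact ⟨z + z', by simp [TensorProduct.tmul_add, Finset.sum_add_distrib]⟩
    | tmul w g =>
      refine ⟨fun i => v.repr w i • g, ?_⟩
      conv_lhs => rw [← v.sum_repr w, TensorProduct.sum_tmul]
      exact Finset.sum_congr rfl fun i _ => TensorProduct.smul_tmul _ _ _
  have hz (j) : ∃ z : Fin (Module.finrank F V) → O, P.comul (v j) = ∑ i, (v i : O) ⊗ₜ z i := by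
    obtain ⟨t, ht⟩ := hV (v j) (v j).2
    obtain ⟨z, rfl⟩ := htensor t
    exact ⟨z, by simp [← ht]⟩
  choose z' hz' using hz
  let z : Matrix (Fin (Module.finrank F V)) (Fin (Module.finrank F V)) O :=
    Matrix.of fun i j => z' j i
  have hmul {A : Type u} [CommRing A] [Algebra F A] (x y : O →ₐ[F] A) (j) :
      P.mul x y (v j) = ∑ i, x (v i) * y (z i j) := by
    rw [mul_eq, AlgHom.comp_apply, hz', map_sum]
    simp only [productMap_apply_tmul]
    rfl
  -- The `v_i` remain independent over `A`: a linear retraction of `O` onto `V` extends their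
  -- coordinates to `O`.
  have hindep {A : Type u} [CommRing A] [Algebra F A] (a a' : Fin (Module.finrank F V) → A)
      (h : ∑ i, (v i : O) ⊗ₜ[F] a i = ∑ i, (v i : O) ⊗ₜ[F] a' i) : a = a' := by
    obtain ⟨π, hπ⟩ := LinearMap.exists_leftInverse_of_injective V.subtype V.ker_subtype
    have hπ' (w : V) : π w = w := congrArg (fun φ => φ w) hπ
    funext k
    have h1 := congrArg ((TensorProduct.lid F A).toLinearMap ∘ₗ (v.coord k ∘ₗ π).rTensor A) h
    simpa [hπ', Finsupp.single_apply] using h1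
  refine ⟨_, z, ?_, ?_, ?_⟩
  · rw [← AlgHom.range_eq_top, ← top_le_iff, ← hs, Algebra.adjoin_le_iff]
    intro f hf
    have hspan (j) :
        (v j : O) ∈ (MvPolynomial.aeval (R := F) fun p : _ × _ => z p.1 p.2).range := by
      have h1 := congrArg (fun φ => φ (v j : O)) (P.one_mul (AlgHom.id F O))
      simp only [hmul, AlgHom.id_apply] at h1
      rw [← h1]
      refine Subalgebra.sum_mem _ fun i _ => ?_
      rw [one_apply, ← Algebra.smul_def]
      have h2 : z i j ∈ (MvPolynomial.aeval (R := F) fun p : _ × _ => z p.1 p.2).range :=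
        ⟨MvPolynomial.X (i, j), by simp⟩
      exact Subalgebra.smul_mem _ h2 _
    have h1 := congrArg Subtype.val (v.sum_repr ⟨f, hsV hf⟩)
    simp only [Submodule.coe_sum, Submodule.coe_smul] at h1
    rw [← h1]
    exact Subalgebra.sum_mem _ fun i _ => Subalgebra.smul_mem _ (hspan i) _
  · intro A _ _ x y
    ext k j
    -- With the generic point as left factor, associativity becomes an identity between combinations
    -- of the `v_i` with coefficients in `A`, which can be compared.
    have h1 := congrArg (fun φ => φ (v j : O)) (P.mul_assoc (includeLeft : O →ₐ[F] O ⊗[F] A)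
      (includeRight.comp x) (includeRight.comp y))
    simp only [← comp_mul, hmul, AlgHom.comp_apply, includeLeft_apply, includeRight_apply,
      tmul_mul_tmul, _root_.mul_one, _root_.one_mul, Finset.sum_mul] at h1
    rw [Finset.sum_comm] at h1
    simp only [← TensorProduct.tmul_sum] at h1
    have h2 := congrFun (hindep _ _ h1) k
    simpa [Matrix.mul_apply] using h2.symm
  · intro A _ _
    ext k j
    have h1 := congrArg (fun φ => φ (v j : O)) (P.mul_one (includeLeft : O →ₐ[F] O ⊗[F] A))
    rw [← P.comp_one (includeRight : A →ₐ[F] O ⊗[F] A)] at h1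
    simp only [hmul, AlgHom.comp_apply, includeLeft_apply, includeRight_apply,
      tmul_mul_tmul, _root_.mul_one, _root_.one_mul] at h1
    have h2 := hindep (fun i => P.one A (z i j)) (Pi.single j 1) (h1.trans (by
      rw [Finset.sum_eq_single j] <;> simp +contextual))
    simpa [Matrix.one_apply, Pi.single_apply] using congrFun h2 k

/-- A trivial block of size two is added so that there are two distinct matrix entries, as the
recognition argument requires, even for the trivial group. -/
theorem exists_isGeneratingMatrix [Algebra.FiniteType F O] :
    ∃ (ι : Type) (_ : Fintype ι) (_ : DecidableEq ι) (_ : Nontrivial ι) (z : Matrix ι ι O),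
      P.IsGeneratingMatrix z := by
  obtain ⟨m, z, hz⟩ := P.exists_isGeneratingMatrix_fin
  refine ⟨Fin m ⊕ Fin 2, inferInstance, inferInstance,
    ⟨Sum.inr 0, Sum.inr 1, by simp⟩, Matrix.fromBlocks z 0 0 1, ?_, ?_, ?_⟩
  · intro f
    obtain ⟨g, rfl⟩ := hz.surjective f
    refine ⟨MvPolynomial.rename (Prod.map Sum.inl Sum.inl) g, ?_⟩
    rw [MvPolynomial.aeval_rename]
    rfl
  · intro A _ _ x y
    have h (w : O →ₐ[F] A) : (Matrix.fromBlocks z 0 0 (1 : Matrix (Fin 2) (Fin 2) O)).map w =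
        Matrix.fromBlocks (z.map w) 0 0 1 := by
      rw [Matrix.fromBlocks_map, Matrix.map_zero _ (_root_.map_zero w),
        Matrix.map_zero _ (_root_.map_zero w),
        Matrix.map_one _ (_root_.map_zero w) (_root_.map_one w)]
    rw [h, h, h, Matrix.fromBlocks_multiply, hz.map_mul]
    simp
  · intro A _ _
    rw [Matrix.fromBlocks_map, Matrix.map_zero _ (_root_.map_zero _),
      Matrix.map_zero _ (_root_.map_zero _),
      Matrix.map_one _ (_root_.map_zero _) (_root_.map_one _), hz.map_one, Matrix.fromBlocks_one]

end PointGroup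

end Representations

/-! ### Scalars and base change in the projective linear group -/

section ProjectiveLinear

variable {F : Type u} [Field F] {W : Type u} [AddCommGroup W] [Module F W]
  {A : Type u} [CommRing A] [Algebra F A]

theorem IsClassOf.of_smul {φ : PGLPoints F W A}
    {g g' : (A ⊗[F] W) ≃ₗ[A] (A ⊗[F] W)} (h : IsClassOf φ g) (α : Aˣ)
    (hg : ∀ w, g w = (α : A) • g' w) : IsClassOf φ g' := by
  intro x w
  have := h x w
  rw [hg, hg, map_smul] at this
  have h2 := congrArg (fun v => ((α⁻¹ : Aˣ) : A) • v) this
  simpa only [smul_smul, Units.inv_mul, one_smul] using h2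

theorem pglMap_injective {B : Type u} [CommRing B] [Algebra F B] {f : A →ₐ[F] B}
    (hf : Function.Injective f) : Function.Injective (pglMap (W := W) f) := by
  have hinj : Function.Injective (endMap (W := W) f) :=
    Module.Flat.rTensor_preserves_injective_linearMap (M := Module.End F W) f.toLinearMap hf
  intro φ ψ h
  ext x
  apply hinj
  rw [← pglMap_endMap, ← pglMap_endMap, h]

end ProjectiveLinear

/-! ### Classes of linear automorphisms and their matrices -/

section Conjugation

variable {F : Type u} [Field F] {J : Type} [Fintype J] {A : Type u} [CommRing A] [Algebra F A]

variable (F J A) in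
theorem tensorProductEnd_bijective :
    Function.Bijective (LinearMap.tensorProductEnd F A (J → F)) := by
  have h := Module.isBaseChange_map_of_finite_free (R := F) (J → F) A J
  have h1 : (LinearMap.tensorProductEnd F A (J → F)).toLinearMap = h.equiv.toLinearMap := by
    apply TensorProduct.AlgebraTensorModule.curry_injective
    apply LinearMap.ext_ring
    refine LinearMap.ext fun e => LinearMap.ext fun w => ?_
    change LinearMap.tensorProductEnd F A (J → F) (1 ⊗ₜ e) w = h.equiv (1 ⊗ₜ e) w
    rw [h.equiv_tmul, one_smul]
    induction w using TensorProduct.induction_on with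
    | zero => simp
    | add x y hx hy => rw [map_add, map_add, hx, hy]
    | tmul a w => rw [tensorProductEnd_tmul, one_mul, LinearMap.baseChangeHom_apply,
        LinearMap.baseChange_tmul]
  have h2 : (LinearMap.tensorProductEnd F A (J → F) : _ → _) = h.equiv :=
    funext fun x => congrArg (fun φ => φ x) h1
  rw [h2]
  exact h.equiv.bijective

variable (F J A) in
/-- The algebra `A ⊗ End(W)` is the endomorphism algebra of `A ⊗ W`. -/
def tensorEndEquiv : (A ⊗[F] Module.End F (J → F)) ≃ₐ[A] Module.End A (A ⊗[F] (J → F)) :=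
  AlgEquiv.ofBijective _ (tensorProductEnd_bijective F J A)

/-- The class in `PGL(W)(A)` of a linear automorphism. -/
def pglClass (g : (A ⊗[F] (J → F)) ≃ₗ[A] (A ⊗[F] (J → F))) : PGLPoints F (J → F) A :=
  ((tensorEndEquiv F J A).trans (g.conjAlgEquiv A)).trans (tensorEndEquiv F J A).symm

theorem isClassOf_pglClass (g : (A ⊗[F] (J → F)) ≃ₗ[A] (A ⊗[F] (J → F))) :
    IsClassOf (pglClass g) g := by
  intro x w
  have h : LinearMap.tensorProductEnd F A (J → F) (pglClass g x) =
      g.conjAlgEquiv A (LinearMap.tensorProductEnd F A (J → F) x) :=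
    (tensorEndEquiv F J A).apply_symm_apply _
  rw [h]
  simp [LinearEquiv.conjAlgEquiv_apply]

theorem IsClassOf.eq_pglClass {φ : PGLPoints F (J → F) A}
    {g : (A ⊗[F] (J → F)) ≃ₗ[A] (A ⊗[F] (J → F))} (h : IsClassOf φ g) : φ = pglClass g := by
  ext x
  apply (tensorProductEnd_bijective F J A).1
  refine LinearMap.ext fun w => ?_
  obtain ⟨w, rfl⟩ := g.surjective w
  rw [h, isClassOf_pglClass]

theorem pglMap_pglClass {B : Type u} [CommRing B] [Algebra F B] [Algebra A B] [IsScalarTower F A B]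
    (g : (A ⊗[F] (J → F)) ≃ₗ[A] (A ⊗[F] (J → F))) :
    pglMap (IsScalarTower.toAlgHom F A B) (pglClass g) = pglClass (glExtend B g) :=
  (isClassOf_pglClass g).extend.eq_pglClass

theorem stdMatrix_toLin [DecidableEq J] (M : Matrix J J A) :
    stdMatrix (Matrix.toLin (stdBasis F J A) (stdBasis F J A) M) = M := by
  ext j j'
  simp [stdMatrix, Matrix.toLin_self, Finsupp.single_apply]

theorem stdMatrix_injective : Function.Injective (stdMatrix (F := F) (J := J) (B := A)) := by
  intro g g' h
  refine (stdBasis F J A).ext fun j' => (stdBasis F J A).ext_elem fun j => ?_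
  exact congrFun (congrFun h j) j'

theorem stdMatrix_comp (g g' : A ⊗[F] (J → F) →ₗ[A] A ⊗[F] (J → F)) :
    stdMatrix (g ∘ₗ g') = stdMatrix g * stdMatrix g' := by
  classical
  have h (g : A ⊗[F] (J → F) →ₗ[A] A ⊗[F] (J → F)) :
      stdMatrix g = LinearMap.toMatrix (stdBasis F J A) (stdBasis F J A) g := by
    ext j j'
    simp [stdMatrix, LinearMap.toMatrix_apply]
  rw [h, h, h, LinearMap.toMatrix_comp _ (stdBasis F J A)]

theorem stdMatrix_id [DecidableEq J] :
    stdMatrix (LinearMap.id : A ⊗[F] (J → F) →ₗ[A] A ⊗[F] (J → F)) = 1 := by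
  ext j j'
  simp [stdMatrix, Matrix.one_apply, Finsupp.single_apply, eq_comm]

section BaseChange

variable {B : Type u} [CommRing B] [Algebra F B] [Algebra A B] [IsScalarTower F A B]

theorem vecMap_stdBasis (j : J) : vecMap (J → F) A B (stdBasis F J A j) = stdBasis F J B j := by
  classical
  rw [stdBasis_apply, stdBasis_apply, vecMap_one]

theorem stdBasis_repr_vecMap (w : A ⊗[F] (J → F)) (j : J) :
    (stdBasis F J B).repr (vecMap (J → F) A B w) j =
      algebraMap A B ((stdBasis F J A).repr w j) := by
  induction w using TensorProduct.induction_on with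
  | zero => simp
  | add x y hx hy => simp only [map_add, Finsupp.add_apply, hx, hy]
  | tmul a w =>
    have : vecMap (J → F) A B (a ⊗ₜ[F] w) = algebraMap A B a ⊗ₜ[F] w := by
      simp [vecMap]
    rw [this, stdBasis_repr_tmul, stdBasis_repr_tmul, map_mul, ← IsScalarTower.algebraMap_apply]

theorem stdMatrix_vecExtend (g : A ⊗[F] (J → F) →ₗ[A] A ⊗[F] (J → F)) :
    stdMatrix (vecExtend B g) = (stdMatrix g).map (algebraMap A B) := by
  ext j j'
  rw [stdMatrix, Matrix.of_apply, ← vecMap_stdBasis (A := A), vecExtend_vecMap,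
    stdBasis_repr_vecMap]
  rfl

end BaseChange

end Conjugation

/-! ### The isomorphism from the group to the stabilizer, on points -/

section GroupToStabilizer

variable {ι : Type} [DecidableEq ι]

theorem leftMulMatrix_mul [Fintype ι] {B : Type*} [CommRing B] (H H' : Matrix ι ι B) :
    leftMulMatrix (H * H') = leftMulMatrix H * leftMulMatrix H' := by
  ext j j'
  rw [Matrix.mul_apply, Fintype.sum_option]
  cases j <;> cases j'
  · simp
  · simp
  · simp
  · simp only [leftMulMatrix_some_some, leftMulMatrix_some_none, leftMulMatrix_none_some,
      mul_zero, zero_add, Fintype.sum_prod_type, Matrix.mul_apply, ite_mul, zero_mul, mul_ite]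
    simp

theorem leftMulMatrix_one {B : Type*} [CommRing B] :
    leftMulMatrix (1 : Matrix ι ι B) = 1 := by
  ext j j'
  cases j <;> cases j'
  · simp
  · simp
  · simp
  · rw [leftMulMatrix_some_some, Matrix.one_apply, Matrix.one_apply]
    simp only [Option.some.injEq, Prod.ext_iff]
    split_ifs <;> simp_all

theorem leftMulMatrix_map {B B' : Type*} [CommRing B] [CommRing B'] (φ : B →+* B')
    (H : Matrix ι ι B) : (leftMulMatrix H).map φ = leftMulMatrix (H.map φ) := by
  ext j j'
  cases j <;> cases j' <;> simp [leftMulMatrix_some_some, apply_ite φ]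

variable [Fintype ι] {F O : Type u} [Field F] [CommRing O] [Algebra F O] {P : PointGroup F O}
  {z : Matrix ι ι O}
variable {A : Type u} [CommRing A] [Algebra F A]

namespace PointGroup.IsGeneratingMatrix

theorem ext (hz : P.IsGeneratingMatrix z) {x y : O →ₐ[F] A} (h : z.map x = z.map y) : x = y := by
  ext f
  obtain ⟨g, rfl⟩ := hz.surjective f
  have (w : O →ₐ[F] A) : w (MvPolynomial.aeval (fun p : ι × ι => z p.1 p.2) g) =
      MvPolynomial.aeval (fun p : ι × ι => z.map w p.1 p.2) g := by
    rw [← AlgHom.comp_apply, MvPolynomial.comp_aeval]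
    rfl
  rw [this, this, h]

theorem leftMul_mul_leftMul_inv (hz : P.IsGeneratingMatrix z) (x : O →ₐ[F] A) :
    leftMulMatrix (z.map x) * leftMulMatrix (z.map (P.inv x)) = 1 := by
  rw [← leftMulMatrix_mul, ← hz.map_mul, P.mul_inv, hz.map_one, leftMulMatrix_one]

theorem leftMul_inv_mul_leftMul (hz : P.IsGeneratingMatrix z) (x : O →ₐ[F] A) :
    leftMulMatrix (z.map (P.inv x)) * leftMulMatrix (z.map x) = 1 := by
  rw [← leftMulMatrix_mul, ← hz.map_mul, P.inv_mul, hz.map_one, leftMulMatrix_one]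

variable (hz : P.IsGeneratingMatrix z)

/-- The action of a point on `W = F ⊕ Mat`. -/
def toGL (x : O →ₐ[F] A) :
    (A ⊗[F] (Option (ι × ι) → F)) ≃ₗ[A] (A ⊗[F] (Option (ι × ι) → F)) :=
  LinearEquiv.ofLinearMap
    (Matrix.toLin (stdBasis F _ A) (stdBasis F _ A) (leftMulMatrix (z.map x)))
    (Matrix.toLin (stdBasis F _ A) (stdBasis F _ A) (leftMulMatrix (z.map (P.inv x))))
    (by rw [← Matrix.toLin_mul, hz.leftMul_mul_leftMul_inv, Matrix.toLin_one])
    (by rw [← Matrix.toLin_mul, hz.leftMul_inv_mul_leftMul, Matrix.toLin_one])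

theorem stdMatrix_toGL (x : O →ₐ[F] A) :
    stdMatrix (hz.toGL x).toLinearMap = leftMulMatrix (z.map x) :=
  stdMatrix_toLin _

theorem stdMatrix_toGL_symm (x : O →ₐ[F] A) :
    stdMatrix (hz.toGL x).symm.toLinearMap = leftMulMatrix (z.map (P.inv x)) :=
  stdMatrix_toLin _

theorem toGL_mul (x y : O →ₐ[F] A) : hz.toGL (P.mul x y) = (hz.toGL y).trans (hz.toGL x) := by
  apply LinearEquiv.toLinearMap_injective
  apply stdMatrix_injective
  rw [LinearEquiv.coe_trans, stdMatrix_comp, stdMatrix_toGL, stdMatrix_toGL, stdMatrix_toGL,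
    hz.map_mul, leftMulMatrix_mul]

theorem glExtend_toGL {B : Type u} [CommRing B] [Algebra F B] [Algebra A B] [IsScalarTower F A B]
    (x : O →ₐ[F] A) :
    glExtend B (hz.toGL x) = hz.toGL ((IsScalarTower.toAlgHom F A B).comp x) := by
  apply LinearEquiv.toLinearMap_injective
  apply stdMatrix_injective
  refine (stdMatrix_vecExtend _).trans ?_
  rw [stdMatrix_toGL, stdMatrix_toGL, leftMulMatrix_map]
  rfl

/-- The class of a point in `PGL(W)`. -/
def toPGL (x : O →ₐ[F] A) : PGLPoints F (Option (ι × ι) → F) A := pglClass (hz.toGL x)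

theorem toPGL_mul (x y : O →ₐ[F] A) : hz.toPGL (P.mul x y) = hz.toPGL x * hz.toPGL y := by
  rw [toPGL, toGL_mul]
  exact ((isClassOf_pglClass _).mul (isClassOf_pglClass _)).eq_pglClass.symm

theorem pglMap_toPGL {B : Type u} [CommRing B] [Algebra F B] (f : A →ₐ[F] B) (x : O →ₐ[F] A) :
    pglMap f (hz.toPGL x) = hz.toPGL (f.comp x) := by
  let _ : Algebra A B := f.toRingHom.toAlgebra
  have : IsScalarTower F A B := IsScalarTower.of_algebraMap_eq fun r => (f.commutes r).symm
  have hf : IsScalarTower.toAlgHom F A B = f := AlgHom.ext fun _ => rfl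
  have := pglMap_pglClass (B := B) (hz.toGL x)
  rwa [glExtend_toGL, hf] at this

end PointGroup.IsGeneratingMatrix

/-- The entry `(k, i)` of the matrix part of an element of `PGL(W)` that fixes the distinguished
vector. -/
def readEntry (φ : PGLPoints F (Option (ι × ι) → F) A) : Matrix ι ι A :=
  Matrix.of fun k i => (stdBasis F (Option (ι × ι)) A).repr
    (LinearMap.tensorProductEnd F A (Option (ι × ι) → F)
      (φ (1 ⊗ₜ (LinearMap.proj none).smulRight (Pi.single (some (i, i)) 1)))
        (stdBasis F (Option (ι × ι)) A none)) (some (k, i))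

/-- Conjugating the endomorphism `e_none ↦ e_(i, i)`, zero on the other basis vectors, by a `g` that
fixes `e_none` gives an endomorphism with `e_none ↦ g e_(i, i)`. So the entries of `g` are recovered
from its class alone. -/
theorem readEntry_of_isClassOf (hz : P.IsGeneratingMatrix z)
    {φ : PGLPoints F (Option (ι × ι) → F) A} {x : O →ₐ[F] A}
    (h : IsClassOf φ (hz.toGL x)) : readEntry φ = z.map x := by
  have hcol (j j') : (stdBasis F _ A).repr (hz.toGL x (stdBasis F _ A j')) j =
      leftMulMatrix (z.map x) j j' := congrFun (congrFun (hz.stdMatrix_toGL x) j) j'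
  have hfix : hz.toGL x (stdBasis F _ A none) = stdBasis F _ A none := by
    refine (stdBasis F _ A).ext_elem fun j => ?_
    rw [hcol]
    cases j <;> simp
  ext k i
  rw [readEntry, Matrix.of_apply]
  conv_lhs => rw [← hfix]
  rw [h, stdBasis_apply, tensorProductEnd_tmul]
  have : (1 * 1 : A) ⊗ₜ[F] ((LinearMap.proj none).smulRight
      (Pi.single (some (i, i)) 1) : Module.End F (Option (ι × ι) → F)) (Pi.single none 1) =
      stdBasis F _ A (some (i, i)) := by
    rw [stdBasis_apply]
    simp
  rw [this, hcol, leftMulMatrix_some_some]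
  simp

theorem readEntry_pglMap {B : Type u} [CommRing B] [Algebra F B] [Algebra A B]
    [IsScalarTower F A B] (φ : PGLPoints F (Option (ι × ι) → F) A) :
    readEntry (pglMap (IsScalarTower.toAlgHom F A B) φ) = (readEntry φ).map (algebraMap A B) := by
  ext k i
  simp only [readEntry, Matrix.map_apply, Matrix.of_apply]
  rw [← stdBasis_repr_vecMap, ← tensorProductEnd_vecMap, ← pglMap_endMap, vecMap_stdBasis]
  simp

variable {low d : ℕ} {S : Set (MvPolynomial (ι × ι) F)}

namespace PointGroup.IsGeneratingMatrix

theorem toPGL_mem_stabPoints (hz : P.IsGeneratingMatrix z) (x : O →ₐ[F] A) :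
    hz.toPGL x ∈ stabPoints (testSpace (matrixTests F z low d) (testDegree ι low d)) A := by
  refine ⟨A, inferInstance, inferInstance, Algebra.id A, inferInstance, inferInstance,
    hz.toGL x, ?_, ?_⟩
  · have : IsScalarTower.toAlgHom F A A = AlgHom.id F A := AlgHom.ext fun _ => rfl
    rw [this, pglMap_id]
    exact isClassOf_pglClass _
  · have hmul (E : Type u) [CommRing E] [Algebra F E] (x y : O →ₐ[F] E) :
        ∃ w : O →ₐ[F] E, z.map w = z.map x * z.map y := ⟨P.mul x y, hz.map_mul x y⟩
    refine stabilizes_testSpace _ (fun f _ h => ?_) fun f _ h => ?_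
    · rw [stdMatrix_toGL]
      exact h.linSubst_leftMulMatrix hmul x
    · rw [stdMatrix_toGL_symm]
      exact h.linSubst_leftMulMatrix hmul (P.inv x)

theorem toPGL_injective (hz : P.IsGeneratingMatrix z) :
    Function.Injective (hz.toPGL (A := A)) := by
  intro x y h
  apply hz.ext
  rw [← readEntry_of_isClassOf hz (isClassOf_pglClass (hz.toGL x)),
    ← readEntry_of_isClassOf hz (isClassOf_pglClass (hz.toGL y))]
  exact congrArg readEntry h

/-- Over a faithfully flat `B` the element comes from a point of the group. The entries of that
point are read from the class, hence lie in `A`, and they satisfy the equations of the group there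
because `A → B` is injective. -/
theorem exists_toPGL_eq [Nontrivial ι] (hz : P.IsGeneratingMatrix z)
    (hlow : Fintype.card (Option ι) + d + 4 ≤ low) (hn : (testDegree ι low d : F) ≠ 0)
    (hS : Ideal.span S = RingHom.ker (MvPolynomial.aeval (R := F) fun p : ι × ι => z p.1 p.2))
    (hd : ∀ g ∈ S, g.totalDegree ≤ d) {φ : PGLPoints F (Option (ι × ι) → F) A}
    (hφ : φ ∈ stabPoints (testSpace (matrixTests F z low d) (testDegree ι low d)) A) :
    ∃ x : O →ₐ[F] A, hz.toPGL x = φ := by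
  obtain ⟨B, _, _, _, _, hB, g, h1, h2⟩ := hφ
  have hAB : Function.Injective (algebraMap A B) := FaithfulSMul.algebraMap_injective A B
  have hinv₁ : stdMatrix g.symm.toLinearMap * stdMatrix g.toLinearMap = 1 := by
    rw [← stdMatrix_comp, LinearEquiv.symm_comp, stdMatrix_id]
  have hinv₂ : stdMatrix g.toLinearMap * stdMatrix g.symm.toLinearMap = 1 := by
    rw [← stdMatrix_comp, LinearEquiv.comp_symm, stdMatrix_id]
  obtain ⟨α, y, hy⟩ := exists_eq_smul_leftMulMatrix hlow hn ⟨P.one B, hz.map_one B⟩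
    hz.surjective hS hd hinv₁ hinv₂ fun f hf h => h2.passes_linSubst _ hf h
  have hgy : g.toLinearMap = (α : B) • (hz.toGL y).toLinearMap := by
    apply stdMatrix_injective
    rw [hy, ← hz.stdMatrix_toGL]
    ext j j'
    simp [stdMatrix]
  -- The scalar `α` acts trivially by conjugation.
  have hclass : IsClassOf (pglMap (IsScalarTower.toAlgHom F A B) φ) (hz.toGL y) :=
    h1.of_smul α fun w => congrArg (fun ψ => ψ w) hgy
  have hread : (readEntry φ).map (algebraMap A B) = z.map y := by
    rw [← readEntry_pglMap, readEntry_of_isClassOf hz hclass]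
  obtain ⟨x, hx⟩ := exists_algHom_map_eq hz.surjective (readEntry φ) fun f hf => by
    apply hAB
    have h3 := congrArg y hf
    rw [map_zero, ← AlgHom.comp_apply, MvPolynomial.comp_aeval] at h3
    rw [map_zero, ← h3, ← IsScalarTower.coe_toAlgHom' F A B, ← AlgHom.comp_apply,
      MvPolynomial.comp_aeval]
    congr 2
    funext p
    exact congrFun (congrFun hread p.1) p.2
  refine ⟨x, pglMap_injective (f := IsScalarTower.toAlgHom F A B) hAB ?_⟩
  rw [hz.pglMap_toPGL, hclass.eq_pglClass, toPGL]
  congr 2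
  apply hz.ext
  rw [← hread, ← hx]
  rfl

end PointGroup.IsGeneratingMatrix

end GroupToStabilizer

/-! ### Points of a group scheme through its algebra of functions -/

section Points

open Opposite MonoidalCategory
open scoped MonObj

variable {F : Type u} [Field F] {C : Type*} [Category* C] (S : (CommAlgCat.{u} F)ᵒᵖ ⥤ C)
  [S.Full] [S.Faithful] {O : Type u} [CommRing O] [Algebra F O] {G : C}
  (i : S.obj (op (CommAlgCat.of F O)) ≅ G)

/-- The points of `G` over an algebra `A`, for `G` represented by the algebra `O`. -/
def pointEquiv (A : Type u) [CommRing A] [Algebra F A] :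
    (O →ₐ[F] A) ≃ (S.obj (op (CommAlgCat.of F A)) ⟶ G) where
  toFun x := S.map (CommAlgCat.ofHom x).op ≫ i.hom
  invFun s := (S.preimage (s ≫ i.inv)).unop.hom
  left_inv x := by simp
  right_inv s := by simp

theorem pointEquiv_comp {A A' : Type u} [CommRing A] [Algebra F A] [CommRing A'] [Algebra F A']
    (f : A →ₐ[F] A') (x : O →ₐ[F] A) :
    pointEquiv S i A' (f.comp x) = S.map (CommAlgCat.ofHom f).op ≫ pointEquiv S i A x := by
  simp [pointEquiv, CommAlgCat.ofHom_comp]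

variable [CartesianMonoidalCategory C] [GrpObj G]

/-- The group structure on the algebra homomorphisms from the algebra of functions of a group. -/
def PointGroup.ofGrpObj : PointGroup F O where
  mul x y := (pointEquiv S i _).symm (pointEquiv S i _ x * pointEquiv S i _ y)
  one A := (pointEquiv S i _).symm 1
  inv x := (pointEquiv S i _).symm (pointEquiv S i _ x)⁻¹
  mul_assoc x y z := by simp [_root_.mul_assoc]
  one_mul x := by simp
  mul_one x := by simp
  mul_inv x := by simp
  inv_mul x := by simp
  comp_mul φ x y := by
    rw [Equiv.eq_symm_apply, pointEquiv_comp, pointEquiv_comp, pointEquiv_comp,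
      Equiv.apply_symm_apply, MonObj.comp_mul]
  comp_one φ := by
    rw [Equiv.eq_symm_apply, pointEquiv_comp, Equiv.apply_symm_apply, MonObj.comp_one]

theorem pointEquiv_mul {A : Type u} [CommRing A] [Algebra F A] (x y : O →ₐ[F] A) :
    pointEquiv S i A ((PointGroup.ofGrpObj S i).mul x y) =
      pointEquiv S i A x * pointEquiv S i A y :=
  Equiv.apply_symm_apply _ _

end Points

theorem finiteType_of_iso {F O : Type u} [Field F] [CommRing O] [Algebra F O]
    {G : Over (Spec (CommRingCat.of F))}
    (i : (algSpec (CommRingCat.of F)).obj (Opposite.op (CommAlgCat.of F O)) ≅ G)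
    [LocallyOfFiniteType G.hom] : Algebra.FiniteType F O := by
  have : IsIso i.hom.left := inferInstanceAs (IsIso ((Over.forget _).map i.hom))
  have h : LocallyOfFiniteType (i.hom.left ≫ G.hom) := inferInstance
  rw [Over.w i.hom] at h
  have hSpec : LocallyOfFiniteType (Spec.map (CommRingCat.ofHom (algebraMap F O))) := h
  exact RingHom.finiteType_algebraMap.1
    ((HasRingHomProperty.Spec_iff (P := @LocallyOfFiniteType)).1 hSpec)

/-- The points of an affine group scheme of finite type, described by its algebra of functions. -/
theorem exists_pointGroup (F : Type u) [Field F] (G : Over (Spec (CommRingCat.of F))) [GrpObj G]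
    [IsAffine G.left] [LocallyOfFiniteType G.hom] :
    ∃ (O : Type u) (_ : CommRing O) (_ : Algebra F O) (_ : Algebra.FiniteType F O)
      (P : PointGroup F O)
      (e : ∀ A : CommAlgCat.{u} F, (O →ₐ[F] A) ≃ (pointsFunctor F G).obj A),
      (∀ (A : CommAlgCat.{u} F) (x y : O →ₐ[F] A), e A (P.mul x y) = e A x * e A y) ∧
      ∀ {A A' : CommAlgCat.{u} F} (f : A ⟶ A') (x : O →ₐ[F] A),
        e A' (f.hom.comp x) = (pointsFunctor F G).map f (e A x) := by
  obtain ⟨O, ⟨i⟩⟩ := essImage_algSpec.2 ‹IsAffine G.left›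
  let S : (CommAlgCat.{u} F)ᵒᵖ ⥤ Over (Spec (CommRingCat.of F)) := algSpec (CommRingCat.of F)
  have : S.Full := algSpec.instFull
  have : S.Faithful := algSpec.instFaithful
  exact ⟨O.unop, inferInstance, inferInstance, finiteType_of_iso (O := O.unop) i,
    PointGroup.ofGrpObj S (O := O.unop) i, fun A => pointEquiv S (O := O.unop) i A,
    fun A x y => pointEquiv_mul S (O := O.unop) i x y,
    fun f x => pointEquiv_comp S (O := O.unop) i f.hom x⟩

/-! ### Choice of the degree, and the properties of the subspace -/

section TestSpace

open MvPolynomial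

variable {ι : Type} [Fintype ι] {F O : Type u} [Field F] [CommRing O]
  [Algebra F O]

theorem exists_span_eq_ker_totalDegree_le (z : Matrix ι ι O) :
    ∃ (S : Set (MvPolynomial (ι × ι) F)) (d : ℕ),
      Ideal.span S = RingHom.ker (aeval (R := F) fun p : ι × ι => z p.1 p.2) ∧
        ∀ g ∈ S, g.totalDegree ≤ d := by
  obtain ⟨S, hS⟩ := IsNoetherian.noetherian
    (RingHom.ker (aeval (R := F) fun p : ι × ι => z p.1 p.2))
  exact ⟨S, S.sup totalDegree, hS, fun g hg => Finset.le_sup hg⟩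

-- The degree grows by one with `low`, and two consecutive integers cannot both vanish in `F`.
variable (ι F) in
theorem exists_le_testDegree_ne_zero (d m : ℕ) :
    ∃ low, m ≤ low ∧ (testDegree ι low d : F) ≠ 0 := by
  by_cases h : (testDegree ι m d : F) = 0
  · refine ⟨m + 1, m.le_succ, fun h' => one_ne_zero (α := F) ?_⟩
    have he : testDegree ι (m + 1) d = testDegree ι m d + 1 := by
      simp only [testDegree, windowStart]
      omega
    rwa [he, Nat.cast_add, h, zero_add, Nat.cast_one] at h'
  · exact ⟨m, le_rfl, h⟩

variable [DecidableEq ι] {z : Matrix ι ι O} {low d : ℕ}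

/-- The polynomial `t^(n - 1) x_p` violates the condition on the exponent `n - 1`, so the passing
polynomials form a proper subspace. -/
theorem one_le_finrank_testSpace (p : ι × ι) :
    1 ≤ Module.finrank F (testSpace (matrixTests F z low d) (testDegree ι low d)) := by
  have hf : (X none ^ (windowStart ι low + d + 1) * X (some p) :
      MvPolynomial (Option (ι × ι)) F).IsHomogeneous (testDegree ι low d) := by
    simpa [testDegree, add_assoc] using
      ((isHomogeneous_X F none).pow (windowStart ι low + d + 1)).mul (isHomogeneous_X F (some p))
  have hnot : ¬ Passes (matrixTests F z low d) (X none ^ (windowStart ι low + d + 1) * X (some p) :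
      MvPolynomial (Option (ι × ι)) F) := fun h => by
    have := (passes_matrixTests_iff.1 h F).2.1 (Matrix.of fun _ _ => 1)
    rw [map_mul, map_pow, pencil_X_none, pencil_X_some, Polynomial.coeff_mul_C,
      Polynomial.coeff_X_pow_self, one_mul, Matrix.of_apply] at this
    exact one_ne_zero this
  exact Submodule.one_le_finrank_iff.2 (testSpace_ne_bot _ hf hnot)

/-- The `n`-th powers of all coordinates pass: `t^n` has exponent `n`, and `x_p^n` has exponent `0 <
low`. If `[w]ₙ` lies in `L_K`, these powers vanish at `w`, which forces `w = 0`. -/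
theorem disjoint_linesIn_veronese (hlow : 1 ≤ low) (K : Type u) [Field K] [Algebra F K] :
    Disjoint
      (linesIn (extendScalars (testDegree ι low d) K
        (testSpace (matrixTests F z low d) (testDegree ι low d))))
      (Set.range (veronese K (testDegree ι low d) (K ⊗[F] (Option (ι × ι) → F)))) := by
  rw [Set.disjoint_right]
  rintro _ ⟨q, rfl⟩ hq
  induction q using Projectivization.ind with
  | h w hw =>
    have hmem : pureSymbol K (testDegree ι low d) w ∈ extendScalars (testDegree ι low d) K
        (testSpace (matrixTests F z low d) (testDegree ι low d)) := by
      apply hq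
      change _ ∈ (Projectivization.mk K _ _).submodule
      rw [Projectivization.submodule_mk]
      exact Submodule.mem_span_singleton_self _
    apply hw
    apply (stdBasis F (Option (ι × ι)) K).repr.injective
    rw [map_zero]
    ext j
    have hpass : Passes (matrixTests F z low d) (X j ^ testDegree ι low d :
        MvPolynomial (Option (ι × ι)) K) := by
      cases j with
      | none => exact passes_X_none_pow
      | some p => exact passes_X_some_pow hlow p _
    have hhom : (X j ^ testDegree ι low d : MvPolynomial (Option (ι × ι)) K).IsHomogeneous
        (testDegree ι low d) := by
      simpa using (isHomogeneous_X K j).pow (testDegree ι low d)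
    have h := aeval_eq_zero_of_pureSymbol_mem _ hmem hhom hpass
    rw [map_pow, aeval_X] at h
    exact eq_zero_of_pow_eq_zero h

end TestSpace

theorem nonempty_iso_stabFunctor {F O : Type u} [Field F] [CommRing O] [Algebra F O]
    {G : Over (Spec (CommRingCat.of F))} [GrpObj G] {P : PointGroup F O}
    (e : ∀ A : CommAlgCat.{u} F, (O →ₐ[F] A) ≃ (pointsFunctor F G).obj A)
    (he : ∀ (A : CommAlgCat.{u} F) (x y : O →ₐ[F] A), e A (P.mul x y) = e A x * e A y)
    (he' : ∀ {A A' : CommAlgCat.{u} F} (f : A ⟶ A') (x : O →ₐ[F] A),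
      e A' (f.hom.comp x) = (pointsFunctor F G).map f (e A x))
    {W : Type u} [AddCommGroup W] [Module F W] {n : ℕ} {L : Submodule F (DividedPower F n W)}
    (ρ : ∀ (A : CommAlgCat.{u} F), (O →ₐ[F] A) ≃ stabPoints L A)
    (hρ : ∀ (A : CommAlgCat.{u} F) (x y : O →ₐ[F] A), ρ A (P.mul x y) = ρ A x * ρ A y)
    (hρ' : ∀ {A A' : CommAlgCat.{u} F} (f : A ⟶ A') (x : O →ₐ[F] A),
      (ρ A' (f.hom.comp x)).1 = pglMap f.hom (ρ A x).1) :
    Nonempty (pointsFunctor F G ≅ stabFunctor L) := by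
  let E (A : CommAlgCat.{u} F) : (pointsFunctor F G).obj A ≃* stabPoints L A :=
    { (e A).symm.trans (ρ A) with
      map_mul' := fun s t => by
        obtain ⟨x, rfl⟩ := (e A).surjective s
        obtain ⟨y, rfl⟩ := (e A).surjective t
        change ρ A ((e A).symm (e A x * e A y)) =
          ρ A ((e A).symm (e A x)) * ρ A ((e A).symm (e A y))
        rw [← he, Equiv.symm_apply_apply, Equiv.symm_apply_apply, Equiv.symm_apply_apply, hρ] }
  refine ⟨NatIso.ofComponents (fun A => (E A).toGrpIso) fun {A A'} f => ?_⟩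
  apply GrpCat.hom_ext
  refine MonoidHom.ext fun s => Subtype.ext ?_
  obtain ⟨x, rfl⟩ := (e A).surjective s
  change (ρ A' ((e A').symm ((pointsFunctor F G).map f (e A x)))).1 =
    pglMap f.hom (ρ A ((e A).symm (e A x))).1
  rw [← he', Equiv.symm_apply_apply, Equiv.symm_apply_apply, hρ']

end DividedTannaka

end

theorem mainTheorem3 (F : Type u) [Field F]
    (G : Over (Spec (CommRingCat.of F))) [GrpObj G] [IsAffine G.left]
    [LocallyOfFiniteType G.hom] :
    ∃ (W : Type u) (_ : AddCommGroup W) (_ : Module F W) (_ : FiniteDimensional F W)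
      (n l : ℕ) (L : Submodule F (DividedTannaka.DividedPower F n W)),
      1 ≤ n ∧ 1 ≤ l ∧ Module.finrank F L = l ∧
      Nonempty (DividedTannaka.pointsFunctor F G ≅ DividedTannaka.stabFunctor L) ∧
      ∀ (K : Type u) [Field K] [Algebra F K],
        Disjoint (DividedTannaka.linesIn (DividedTannaka.extendScalars n K L))
          (Set.range (DividedTannaka.veronese K n (K ⊗[F] W))) := by
  open DividedTannaka in
  obtain ⟨O, _, _, _, P, e, he, he'⟩ := exists_pointGroup F G
  obtain ⟨ι, _, _, _, z, hz⟩ := P.exists_isGeneratingMatrix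
  obtain ⟨S, d, hS, hd⟩ := exists_span_eq_ker_totalDegree_le (F := F) z
  obtain ⟨low, hlow, hn⟩ :=
    exists_le_testDegree_ne_zero ι F d (Fintype.card (Option ι) + d + 4)
  refine ⟨Option (ι × ι) → F, inferInstance, inferInstance, inferInstance, testDegree ι low d, _,
    testSpace (matrixTests F z low d) (testDegree ι low d), ?_,
    one_le_finrank_testSpace (Classical.arbitrary _), rfl, ?_,
    fun K _ _ => disjoint_linesIn_veronese (by omega) K⟩
  · simp only [testDegree]
    omega
  · exact nonempty_iso_stabFunctor e he he'
      (fun A => Equiv.ofBijective (fun x => ⟨hz.toPGL x, hz.toPGL_mem_stabPoints x⟩)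
        ⟨fun x y h => hz.toPGL_injective (congrArg Subtype.val h), fun φ => by
          obtain ⟨x, hx⟩ := hz.exists_toPGL_eq hlow hn hS hd φ.2
          exact ⟨x, Subtype.ext hx⟩⟩)
      (fun A x y => Subtype.ext (hz.toPGL_mul x y))
      (fun f x => (hz.pglMap_toPGL f.hom x).symm)
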